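/- For an integer $k\ge 1$, a $k$-CNF formula is a conjunction of finitely many clauses, each of which is a disjunction of exactly $k$ distinct literals (a literal is a Boolean variable or its negation). Two distinct clauses intersect if some variable occurs (negated or not) in both of them. Let $l(k)$ be the largest integer such that every $k$-CNF formula in which each clause intersects at most $l(k)$ other clauses is satisfiable. Then $l(k)$ exists for every $k\ge 1$, and $$\left\lfloor\frac{2^k}{e}\right\rfloor-1\le l(k)=\left(\frac1e+O\left(k^{-1/2}\right)\right)2^k ,$$ that is, the inequality holds for every $k\ge1$, and there is an absolute constant $K$ such that $\left|l(k)/2^k-1/e\right|\le K\,k^{-1/2}$ for every $k\ge 1$. -/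

import Mathlib

namespace KSat

/-- A literal over the variable set `V`: a variable together with a sign, `(x, true)` being the
literal `x` and `(x, false)` its negation. -/
abbrev Literal (V : Type*) := V × Bool

/-- A clause: the disjunction of finitely many distinct literals. -/
abbrev Clause (V : Type*) := Finset (Literal V)

/-- A CNF formula: the conjunction of finitely many clauses. -/
abbrev CNF (V : Type*) := Finset (Clause V)

variable {V : Type*} [DecidableEq V]

/-- The set of variables occurring (negated or not) in a clause. -/
def Clause.vars (C : Clause V) : Finset V := C.image Prod.fst

/-- A `k`-CNF: every clause has exactly `k` distinct literals. -/
def IsKCNF (k : ℕ) (F : CNF V) : Prop := ∀ C ∈ F, C.card = k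

/-- An assignment satisfies a formula if it makes some literal of every clause true. -/
def Satisfies (a : V → Bool) (F : CNF V) : Prop := ∀ C ∈ F, ∃ p ∈ C, a p.1 = p.2

/-- A formula is satisfiable if some assignment satisfies it. -/
def Satisfiable (F : CNF V) : Prop := ∃ a : V → Bool, Satisfies a F

/-- The clauses of `F` other than `C` that intersect `C`, that is, share a variable with it. -/
def neighbors (F : CNF V) (C : Clause V) : Finset (Clause V) :=
  F.filter fun D => D ≠ C ∧ (Clause.vars C ∩ Clause.vars D).Nonempty

/-- `d` is admissible for `k` if every `k`-CNF all of whose clauses intersect at most `d` other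
clauses is satisfiable. The variables are taken from the infinite set `ℕ`. -/
def Admissible (k d : ℕ) : Prop :=
  ∀ F : CNF ℕ, IsKCNF k F → (∀ C ∈ F, (neighbors F C).card ≤ d) → Satisfiable F

/-- The largest number admissible for `k`. -/
noncomputable def l (k : ℕ) : ℕ := sSup {d : ℕ | Admissible k d}

end KSat

/-! Lower bound: the symmetric local lemma makes a formula satisfiable once `2⁻ᵏ ≤ x (1 - x) ^ d`,
and `x = 1 / (d + 1)` reduces this to `d + 1 ≤ 2ᵏ / e`. Counting models replaces probability.

Upper bound: in a binary tree whose leaves have depth at least `k`, let inner nodes be variables and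
let each leaf carry the clause falsified by its last `k` edges. An assignment, read as directions,
leads to a leaf whose clause it violates. If each node sees at most `d` leaves fewer than `k` edges
below it, a clause meets at most `k * d` others (`not_admissible_of_sparse`). So a tree with `d ≈ 2ᵏ
/ (e k)` is needed (`exists_sparse_tree`).

It consists of generations of `R ≈ √k` levels. A node is described by the numbers of leaves at each
distance below `k`. In a generation, `a` of the `2 ^ R` descendants are completed, by Kraft's
inequality, from the oldest leaves alone; the others share the remaining leaves equally. If `u n` is
the unfinished fraction, leaves of age `j` get concentrated by the factor `u (n - j) / u n`. With `M
= R - 3` ages and a steady rate `α = a / 2 ^ R` this factor is about `e ^ (α M)` at age `M`, and the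
Kraft condition becomes `α M ≤ e ^ (α M - 1)`. It holds for every `α`, with equality at `α M = 1`;
this is the origin of `1 / e`. Hence `α` can be raised slowly from `0` past the critical value until
one node owns enough leaves to be completed on its own. All errors are of relative size `O(1 / R)`.
-/

namespace KSat

/-! ### Binary trees and their leaf paths -/

/-- Proper binary trees. -/
inductive BinTree
  | leaf : BinTree
  | node : BinTree → BinTree → BinTree

namespace BinTree

/-- The number of leaves at distance `i` from the root. -/
def leafCount : BinTree → ℕ → ℕ
  | leaf, 0 => 1
  | leaf, _ + 1 => 0
  | node _ _, 0 => 0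
  | node l r, i + 1 => leafCount l i + leafCount r i

/-- From every node of the tree at most `d` leaves are reachable by descending fewer than `k`
edges. -/
def Sparse (k d : ℕ) : BinTree → Prop
  | leaf => ∑ i ∈ Finset.range k, leafCount leaf i ≤ d
  | node l r => ∑ i ∈ Finset.range k, leafCount (node l r) i ≤ d ∧ Sparse k d l ∧ Sparse k d r

/-- The paths to the leaves of a tree hanging at the node with path `p`. Paths list the most recent
step first, so that the ancestors of a node are the suffixes of its path. -/
def leafPaths : BinTree → List Bool → Finset (List Bool)
  | leaf, p => {p}
  | node l r, p => leafPaths l (false :: p) ∪ leafPaths r (true :: p)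

theorem suffix_of_mem_leafPaths {T : BinTree} {p q : List Bool} (h : q ∈ leafPaths T p) :
    p <:+ q := by
  induction T generalizing p with
  | leaf => simp [leafPaths] at h; simp [h]
  | node l r ihl ihr =>
    simp only [leafPaths, Finset.mem_union] at h
    rcases h with h | h
    · exact (List.suffix_cons _ _).trans (ihl h)
    · exact (List.suffix_cons _ _).trans (ihr h)

theorem eq_of_cons_suffix_of_cons_suffix {b c : Bool} {p q : List Bool}
    (h₁ : b :: p <:+ q) (h₂ : c :: p <:+ q) : b = c := by
  have := List.suffix_of_suffix_length_le h₁ h₂ (by simp)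
  have := this.eq_of_length (by simp)
  simpa using this

theorem disjoint_leafPaths (l r : BinTree) (p : List Bool) :
    Disjoint (leafPaths l (false :: p)) (leafPaths r (true :: p)) := by
  rw [Finset.disjoint_left]
  intro q h₁ h₂
  have := eq_of_cons_suffix_of_cons_suffix (suffix_of_mem_leafPaths h₁) (suffix_of_mem_leafPaths h₂)
  simp at this

theorem card_filter_leafPaths (T : BinTree) (p : List Bool) (k : ℕ) :
    ((leafPaths T p).filter fun q => q.length < p.length + k).card =
      ∑ i ∈ Finset.range k, leafCount T i := by
  induction T generalizing p k with
  | leaf =>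
    cases k with
    | zero => simp [leafPaths]
    | succ k =>
      rw [Finset.sum_range_succ']
      simp [leafPaths, leafCount, Finset.filter_singleton]
  | node l r ihl ihr =>
    cases k with
    | zero =>
      simp only [add_zero, Finset.range_zero, Finset.sum_empty, Finset.card_eq_zero]
      apply Finset.filter_false_of_mem
      intro q hq
      simpa using (suffix_of_mem_leafPaths hq).length_le
    | succ k =>
      rw [Finset.sum_range_succ', leafPaths, Finset.filter_union, Finset.card_union_of_disjoint
        ((disjoint_leafPaths l r p).mono (Finset.filter_subset _ _) (Finset.filter_subset _ _))]
      have h₁ := ihl (false :: p) k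
      have h₂ := ihr (true :: p) k
      simp only [List.length_cons] at h₁ h₂
      rw [add_assoc, add_comm 1 k] at h₁ h₂
      simp only [leafCount, Finset.sum_add_distrib, add_zero, ← h₁, ← h₂]

/-- Translates the recursive `Sparse` into paths by descending from `p` towards `s`: only the
subtree on the side of `s` counts. The path `s` need not be a node of the tree. -/
theorem Sparse.card_filter_le {k d : ℕ} {T : BinTree} (h : Sparse k d T) {p s : List Bool}
    (hs : p <:+ s) :
    ((leafPaths T p).filter fun q => s <:+ q ∧ q.length < s.length + k).card ≤ d := by
  induction T generalizing p with
  | leaf =>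
    refine le_trans (Finset.card_le_card ?_) ((card_filter_leafPaths leaf p k).trans_le h)
    intro q hq
    simp only [leafPaths, Finset.mem_filter, Finset.mem_singleton] at hq ⊢
    obtain ⟨rfl, hq, hl⟩ := hq
    have := hs.length_le
    have := hq.length_le
    exact ⟨rfl, by omega⟩
  | node l r ihl ihr =>
    rcases eq_or_ne p s with rfl | hne
    · refine le_trans (Finset.card_le_card ?_) ((card_filter_leafPaths (node l r) p k).trans_le h.1)
      intro q hq
      rw [Finset.mem_filter] at hq ⊢
      exact ⟨hq.1, hq.2.2⟩
    · obtain ⟨t, rfl⟩ := hs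
      obtain rfl | ⟨t, b, rfl⟩ := t.eq_nil_or_concat'
      · simp at hne
      have hb : b :: p <:+ t ++ [b] ++ p := ⟨t, by simp⟩
      cases b
      · refine le_trans (Finset.card_le_card ?_) (ihl h.2.1 hb)
        intro q hq
        simp only [leafPaths, Finset.mem_filter, Finset.mem_union] at hq ⊢
        refine ⟨hq.1.resolve_right fun hr => ?_, hq.2⟩
        have := eq_of_cons_suffix_of_cons_suffix (hb.trans hq.2.1) (suffix_of_mem_leafPaths hr)
        simp at this
      · refine le_trans (Finset.card_le_card ?_) (ihr h.2.2 hb)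
        intro q hq
        simp only [leafPaths, Finset.mem_filter, Finset.mem_union] at hq ⊢
        refine ⟨hq.1.resolve_left fun hr => ?_, hq.2⟩
        have := eq_of_cons_suffix_of_cons_suffix (hb.trans hq.2.1) (suffix_of_mem_leafPaths hr)
        simp at this

/-- Following the directions prescribed by `a`, one arrives at a leaf. -/
theorem exists_leafPath_follows (a : List Bool → Bool) (T : BinTree) {p : List Bool}
    (hp : ∀ b s, b :: s <:+ p → b = a s) :
    ∃ q ∈ leafPaths T p, ∀ b s, b :: s <:+ q → b = a s := by
  induction T generalizing p with
  | leaf => exact ⟨p, by simp [leafPaths], hp⟩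
  | node l r ihl ihr =>
    have key : ∀ b s, b :: s <:+ a p :: p → b = a s := by
      intro b s h
      rcases List.suffix_cons_iff.1 h with h | h
      · simp only [List.cons.injEq] at h
        rw [h.1, h.2]
      · exact hp b s h
    cases hap : a p
    · rw [hap] at key
      obtain ⟨q, hq, h⟩ := ihl key
      exact ⟨q, by simp [leafPaths, hq], h⟩
    · rw [hap] at key
      obtain ⟨q, hq, h⟩ := ihr key
      exact ⟨q, by simp [leafPaths, hq], h⟩

theorem exists_branching {T : BinTree} {p q q' : List Bool} (hq : q ∈ leafPaths T p)
    (hq' : q' ∈ leafPaths T p) (hne : q ≠ q') : ∃ b t, b :: t <:+ q ∧ (!b) :: t <:+ q' := by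
  induction T generalizing p with
  | leaf => simp [leafPaths] at hq hq'; exact absurd (hq.trans hq'.symm) hne
  | node l r ihl ihr =>
    simp only [leafPaths, Finset.mem_union] at hq hq'
    rcases hq with hq | hq <;> rcases hq' with hq' | hq'
    · exact ihl hq hq'
    · exact ⟨false, p, suffix_of_mem_leafPaths hq, suffix_of_mem_leafPaths hq'⟩
    · exact ⟨true, p, suffix_of_mem_leafPaths hq, suffix_of_mem_leafPaths hq'⟩
    · exact ihr hq hq'

end BinTree

open BinTree

/-! ### Unsatisfiable formulas from sparse trees -/

/-- The clause read off the last `k` edges of a path: an edge leaving the node `s` in direction `b`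
contributes the literal of the variable `s` that fails when this variable has value `b`. -/
def pathClause : ℕ → List Bool → Clause ℕ
  | 0, _ => ∅
  | _ + 1, [] => ∅
  | k + 1, b :: s => insert (Encodable.encode s, !b) (pathClause k s)

theorem mem_pathClause {k : ℕ} {q : List Bool} {x : Literal ℕ} (h : x ∈ pathClause k q) :
    ∃ b s, b :: s <:+ q ∧ q.length ≤ s.length + k ∧ x = (Encodable.encode s, !b) := by
  induction k generalizing q with
  | zero => simp [pathClause] at h
  | succ k ih =>
    cases q with
    | nil => simp [pathClause] at h
    | cons b s =>
      simp only [pathClause, Finset.mem_insert] at h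
      rcases h with h | h
      · exact ⟨b, s, List.suffix_refl _, by simp, h⟩
      · obtain ⟨b', s', h₁, h₂, h₃⟩ := ih h
        exact ⟨b', s', h₁.trans (List.suffix_cons _ _), by simp; omega, h₃⟩

theorem card_pathClause {k : ℕ} {q : List Bool} (h : k ≤ q.length) : (pathClause k q).card = k := by
  induction k generalizing q with
  | zero => simp [pathClause]
  | succ k ih =>
    cases q with
    | nil => simp at h
    | cons b s =>
      rw [pathClause, Finset.card_insert_of_notMem, ih (by simpa using h)]
      intro hmem
      obtain ⟨b', s', h₁, -, h₃⟩ := mem_pathClause hmem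
      simp only [Prod.mk.injEq, Encodable.encode_inj] at h₃
      have := h₁.length_le
      rw [h₃.1] at this
      simp at this

/-- The path of the sibling. -/
def sibling : List Bool → List Bool
  | [] => []
  | b :: s => (!b) :: s

/-- If the clauses of `q` and `q'` share a variable, then `q'` lies below the sibling of one of the
last `k` nodes on the path to `q`, fewer than `k` edges down. Each of these `k` siblings accounts
for at most `d` leaves. -/
theorem not_admissible_of_sparse {k d : ℕ} {T : BinTree} (hT : T.Sparse k d)
    (hdepth : ∀ i < k, T.leafCount i = 0) : ¬ Admissible k (k * d) := by
  classical
  have hlen : ∀ q ∈ T.leafPaths [], k ≤ q.length := by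
    intro q hq
    have h := card_filter_leafPaths T [] k
    rw [Finset.sum_eq_zero (by simpa using hdepth), Finset.card_eq_zero,
      Finset.filter_eq_empty_iff] at h
    simpa using h hq
  intro hadm
  obtain ⟨a, ha⟩ := hadm ((T.leafPaths []).image (pathClause k)) (by
      intro C hC
      obtain ⟨q, hq, rfl⟩ := Finset.mem_image.1 hC
      exact card_pathClause (hlen q hq)) (by
      intro C hC
      obtain ⟨q, hq, rfl⟩ := Finset.mem_image.1 hC
      have hsub : neighbors ((T.leafPaths []).image (pathClause k)) (pathClause k q) ⊆
          (Finset.range k).biUnion fun j => ((T.leafPaths []).filter fun q' =>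
            sibling (q.drop j) <:+ q' ∧ q'.length < (sibling (q.drop j)).length + k).image
              (pathClause k) := by
        intro D hD
        simp only [neighbors, Finset.mem_filter] at hD
        obtain ⟨hD, hne, v, hv⟩ := hD
        obtain ⟨q', hq', rfl⟩ := Finset.mem_image.1 hD
        simp only [Clause.vars, Finset.mem_inter, Finset.mem_image] at hv
        obtain ⟨⟨x, hx, hxv⟩, ⟨y, hy, hyv⟩⟩ := hv
        obtain ⟨b, s, hs, hsl, rfl⟩ := mem_pathClause hx
        obtain ⟨b', s', hs', hsl', rfl⟩ := mem_pathClause hy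
        have : s' = s := by simpa using hyv.trans hxv.symm
        subst this
        obtain ⟨c, t, ht, ht'⟩ := exists_branching hq hq' (fun h => hne (by rw [h]))
        -- The shared variable is at or above the branching node `t`: a common ancestor strictly
        -- below `t` would make both paths leave `t` in the same direction.
        have hst : s'.length ≤ t.length := by
          by_contra! hlt
          have h₁ := List.suffix_of_suffix_length_le ht ((List.suffix_cons _ _).trans hs)
            (by simpa using hlt)
          have h₂ := List.suffix_of_suffix_length_le ht' ((List.suffix_cons _ _).trans hs')
            (by simpa using hlt)
          have := eq_of_cons_suffix_of_cons_suffix h₁ h₂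
          simp at this
        obtain ⟨w, rfl⟩ := ht
        simp only [Finset.mem_biUnion, Finset.mem_range, Finset.mem_image, Finset.mem_filter]
        simp only [List.length_append, List.length_cons] at hsl
        -- Dropping `w.length` steps from `q` leads to the child of `t` on its path, whose sibling
        -- is the ancestor of `q'`.
        refine ⟨w.length, by omega, q', ⟨hq', ?_⟩, rfl⟩
        simp only [List.drop_left, sibling, List.length_cons]
        exact ⟨ht', by omega⟩
      refine (Finset.card_le_card hsub).trans (Finset.card_biUnion_le.trans ?_)
      refine (Finset.sum_le_card_nsmul _ _ d fun j _ => ?_).trans (by simp)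
      exact Finset.card_image_le.trans (hT.card_filter_le (List.nil_suffix)))
  obtain ⟨q, hq, hfol⟩ := exists_leafPath_follows (fun s => a (Encodable.encode s)) T
    (p := []) (by simp)
  obtain ⟨x, hx, hax⟩ := ha _ (Finset.mem_image_of_mem _ hq)
  obtain ⟨b, s, hs, -, rfl⟩ := mem_pathClause hx
  have := hfol b s hs
  simp only at hax
  rw [hax] at this
  simp at this

/-! ### Assembling sparse trees: complete trees and Kraft forests -/

namespace BinTree

theorem sparse_of_sum_le {k d : ℕ} {T : BinTree}
    (h : ∀ m, ∑ i ∈ Finset.range m, leafCount T i ≤ d) : Sparse k d T := by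
  induction T with
  | leaf => exact h k
  | node l r ihl ihr =>
    have h' : ∀ m, ∑ i ∈ Finset.range m, leafCount l i + ∑ i ∈ Finset.range m, leafCount r i ≤ d := by
      intro m
      have := h (m + 1)
      rw [Finset.sum_range_succ'] at this
      simpa [leafCount, Finset.sum_add_distrib] using this
    exact ⟨h k, ihl fun m => by have := h' m; omega, ihr fun m => by have := h' m; omega⟩

/-- The complete binary tree of height `H` with the trees `f 0, …, f (2 ^ H - 1)` hanging at its
leaves. -/
def complete : ℕ → (ℕ → BinTree) → BinTree
  | 0, f => f 0
  | H + 1, f => node (complete H f) (complete H fun v => f (2 ^ H + v))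

theorem leafCount_complete_of_lt {H i : ℕ} (f : ℕ → BinTree) (hi : i < H) :
    leafCount (complete H f) i = 0 := by
  induction H generalizing f i with
  | zero => omega
  | succ H ih =>
    cases i with
    | zero => simp [complete, leafCount]
    | succ i => simp [complete, leafCount, ih _ (by omega : i < H)]

theorem leafCount_complete (H i : ℕ) (f : ℕ → BinTree) :
    leafCount (complete H f) (i + H) = ∑ v ∈ Finset.range (2 ^ H), leafCount (f v) i := by
  induction H generalizing f with
  | zero => simp [complete]
  | succ H ih => rw [complete, ← add_assoc, leafCount, ih, ih, pow_succ, mul_two, Finset.sum_range_add]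

theorem sum_leafCount_complete (k H : ℕ) (f : ℕ → BinTree) :
    ∑ i ∈ Finset.range k, leafCount (complete H f) i =
      ∑ v ∈ Finset.range (2 ^ H), ∑ i ∈ Finset.range (k - H), leafCount (f v) i := by
  rcases le_total k H with h | h
  · rw [Nat.sub_eq_zero_of_le h, Finset.sum_eq_zero]
    · simp
    · intro i hi
      exact leafCount_complete_of_lt f ((Finset.mem_range.1 hi).trans_le h)
  · obtain ⟨m, rfl⟩ := Nat.exists_eq_add_of_le h
    rw [Finset.sum_range_add, Finset.sum_eq_zero, zero_add, Nat.add_sub_cancel_left,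
      Finset.sum_comm]
    · exact Finset.sum_congr rfl fun i _ => by rw [add_comm H i, leafCount_complete]
    · intro i hi
      exact leafCount_complete_of_lt f (Finset.mem_range.1 hi)

/-- A node at height `j` above the hanging roots sees `2 ^ j` consecutive trees, each to depth `k -
j`. Allowing every offset `o` passes the hypothesis to both halves without tracking alignment. -/
theorem sparse_complete {k d H : ℕ} {f : ℕ → BinTree} (hf : ∀ v, Sparse k d (f v))
    (h : ∀ j ≤ H, ∀ o, ∑ v ∈ Finset.range (2 ^ j), ∑ i ∈ Finset.range (k - j),
      leafCount (f (o + v)) i ≤ d) : Sparse k d (complete H f) := by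
  induction H generalizing f with
  | zero => exact hf 0
  | succ H ih =>
    refine ⟨?_, ih hf fun j hj => h j (by omega), ih (fun v => hf _) fun j hj o => ?_⟩
    · have := h (H + 1) le_rfl 0
      simp only [zero_add] at this
      rwa [← sum_leafCount_complete] at this
    · have := h j (by omega) (2 ^ H + o)
      simpa only [add_assoc] using this

/-- Kraft's inequality for forests: `N` trees with at most `x i` leaves at distance `i`. -/
theorem exists_forest {n N : ℕ} {x : ℕ → ℕ}
    (h : N * 2 ^ n ≤ ∑ i ∈ Finset.range (n + 1), x i * 2 ^ (n - i)) :
    ∃ f : ℕ → BinTree, (∀ i ≤ n, ∑ v ∈ Finset.range N, leafCount (f v) i ≤ x i) ∧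
      ∀ i > n, ∑ v ∈ Finset.range N, leafCount (f v) i = 0 := by
  induction n generalizing N x with
  | zero =>
    refine ⟨fun _ => leaf, fun i hi => ?_, fun i hi => ?_⟩
    · obtain rfl : i = 0 := by omega
      simpa [leafCount] using h
    · obtain ⟨j, rfl⟩ := Nat.exists_eq_succ_of_ne_zero (by omega : i ≠ 0)
      simp [leafCount]
  | succ n ih =>
    -- Up to `x 0` roots become leaves; the others branch and give `2 * (N - x 0)` roots for the
    -- shifted sequence. Truncated subtraction covers `x 0 ≥ N`.
    have h' : (2 * (N - x 0)) * 2 ^ n ≤ ∑ i ∈ Finset.range (n + 1), x (i + 1) * 2 ^ (n - i) := by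
      rw [Finset.sum_range_succ'] at h
      simp only [Nat.add_sub_add_right, Nat.sub_zero] at h
      rw [mul_comm 2, mul_assoc, ← pow_succ', Nat.sub_mul]
      omega
    obtain ⟨f, hf, hf'⟩ := ih h'
    have hsucc : ∀ i, ∑ v ∈ Finset.range N, leafCount
        (if v < N - x 0 then node (f (2 * v)) (f (2 * v + 1)) else leaf) (i + 1) =
          ∑ v ∈ Finset.range (2 * (N - x 0)), leafCount (f v) i := by
      intro i
      have hpair : ∀ m, ∑ v ∈ Finset.range m, (leafCount (f (2 * v)) i + leafCount (f (2 * v + 1)) i)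
          = ∑ v ∈ Finset.range (2 * m), leafCount (f v) i := by
        intro m
        induction m with
        | zero => simp
        | succ m ihm =>
          rw [Finset.sum_range_succ, ihm, mul_add, mul_one, Finset.sum_range_succ,
            Finset.sum_range_succ, add_assoc]
      rw [← hpair]
      symm
      refine Finset.sum_subset_zero_on_sdiff (Finset.range_subset_range.2 (Nat.sub_le _ _)) ?_ ?_
      · intro v hv
        simp only [Finset.mem_sdiff, Finset.mem_range] at hv
        rw [if_neg hv.2, leafCount]
      · intro v hv
        rw [if_pos (Finset.mem_range.1 hv), leafCount]
    refine ⟨fun v => if v < N - x 0 then node (f (2 * v)) (f (2 * v + 1)) else leaf,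
      fun i hi => ?_, fun i hi => ?_⟩
    · cases i with
      | zero =>
        have hzero : ∀ v ∈ Finset.range N, leafCount
            (if v < N - x 0 then node (f (2 * v)) (f (2 * v + 1)) else leaf) 0 =
              if v < N - x 0 then 0 else 1 := by
          intro v _
          split_ifs <;> rfl
        rw [Finset.sum_congr rfl hzero, ← Finset.sum_range_add_sum_Ico _ (Nat.sub_le N (x 0)),
          Finset.sum_eq_zero, zero_add]
        · refine (Finset.sum_le_card_nsmul _ _ 1 fun v _ => by split_ifs <;> simp).trans ?_
          simp only [Nat.card_Ico, smul_eq_mul, mul_one]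
          omega
        · intro v hv
          rw [if_pos (Finset.mem_range.1 hv)]
      | succ i => exact (hsucc i).trans_le (hf i (by omega))
    · obtain ⟨j, rfl⟩ := Nat.exists_eq_succ_of_ne_zero (by omega : i ≠ 0)
      exact (hsucc j).trans (hf' j (by omega))

/-- A single tree of a forest is sparse if the whole forest has few leaves. -/
theorem sparse_of_forest {k d n N : ℕ} {x : ℕ → ℕ} {f : ℕ → BinTree}
    (hf : ∀ i ≤ n, ∑ v ∈ Finset.range N, leafCount (f v) i ≤ x i)
    (hf' : ∀ i > n, ∑ v ∈ Finset.range N, leafCount (f v) i = 0)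
    (hx : ∑ i ∈ Finset.range (n + 1), x i ≤ d) {v : ℕ} (hv : v < N) : Sparse k d (f v) := by
  apply sparse_of_sum_le
  intro m
  have hle : ∀ i, leafCount (f v) i ≤ ∑ v ∈ Finset.range N, leafCount (f v) i := fun i =>
    Finset.single_le_sum (f := fun v => leafCount (f v) i) (fun _ _ => Nat.zero_le _)
      (Finset.mem_range.2 hv)
  calc ∑ i ∈ Finset.range m, leafCount (f v) i
      ≤ ∑ i ∈ Finset.range (n + 1), leafCount (f v) i := by
        refine Finset.sum_le_sum_of_ne_zero fun i _ hi => ?_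
        by_contra hin
        have := hle i
        rw [hf' i (by simpa using hin)] at this
        omega
    _ ≤ ∑ i ∈ Finset.range (n + 1), x i :=
        Finset.sum_le_sum fun i hi =>
          (hle i).trans (hf i (by simpa [Nat.lt_succ_iff] using Finset.mem_range.1 hi))
    _ ≤ d := hx

end BinTree

/-! ### Leaf profiles and the passage between generations -/

/-- There is a sparse tree with at most `x t` leaves at distance `k - 1 - t` from the root. -/
def Constructible (k d : ℕ) (x : ℕ → ℝ) : Prop :=
  ∃ T : BinTree, T.Sparse k d ∧ ∀ i < k, T.leafCount i ≤ ⌊x (k - 1 - i)⌋₊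

/-- The leaves below an unfinished node of generation `n`: the leaves introduced `j` generations
ago are those with `t / R = j`, and `u n` is the fraction of nodes unfinished in generation `n`. -/
noncomputable def profile (D : ℝ) (R M : ℕ) (u : ℕ → ℝ) (n t : ℕ) : ℝ :=
  if t < R * (M + 1) then D / 2 ^ (t + 1) * (u (n - t / R) / u n) else 0

theorem sum_two_pow_le (m : ℕ) : ∑ i ∈ Finset.range m, (2 : ℝ) ^ i ≤ 2 ^ m := by
  rw [geom_sum_eq (by norm_num)]
  norm_num

/-- Rounding down costs at most `1 + 2 + ⋯ + 2 ^ (L - 1)` on the `L` deepest levels; the other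
levels are dropped. -/
theorem le_sum_floor_mul_two_pow (y : ℕ → ℝ) {n L : ℕ} (h : L ≤ n + 1) :
    ∑ s ∈ Finset.range L, y (n - s) * 2 ^ s - 2 ^ L ≤
      ((∑ i ∈ Finset.range (n + 1), ⌊y i⌋₊ * 2 ^ (n - i) : ℕ) : ℝ) := by
  rw [← Finset.sum_range_reflect (fun i => ⌊y i⌋₊ * 2 ^ (n - i)), Nat.cast_sum]
  calc ∑ s ∈ Finset.range L, y (n - s) * 2 ^ s - 2 ^ L
      ≤ ∑ s ∈ Finset.range L, y (n - s) * 2 ^ s - ∑ s ∈ Finset.range L, (2 : ℝ) ^ s :=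
        sub_le_sub_left (sum_two_pow_le L) _
    _ = ∑ s ∈ Finset.range L, (y (n - s) - 1) * 2 ^ s := by
        rw [← Finset.sum_sub_distrib]
        exact Finset.sum_congr rfl fun s _ => by ring
    _ ≤ ∑ s ∈ Finset.range L,
          ((⌊y (n + 1 - 1 - s)⌋₊ * 2 ^ (n - (n + 1 - 1 - s)) : ℕ) : ℝ) := by
        refine Finset.sum_le_sum fun s hs => ?_
        have hs' := Finset.mem_range.1 hs
        rw [Nat.add_sub_cancel, Nat.sub_sub_self (by omega)]
        push_cast
        have := (Nat.sub_one_lt_floor (y (n - s))).le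
        gcongr
    _ ≤ _ := Finset.sum_le_sum_of_subset_of_nonneg (Finset.range_subset_range.2 h)
        fun _ _ _ => Nat.cast_nonneg _

theorem sum_range_mul_div (R m : ℕ) (φ : ℕ → ℝ) (hR : 0 < R) :
    ∑ s ∈ Finset.range (R * m), φ (s / R) = R * ∑ j ∈ Finset.range m, φ j := by
  induction m with
  | zero => simp
  | succ m ih =>
    rw [mul_add, mul_one, Finset.sum_range_add, ih, Finset.sum_range_succ, mul_add]
    congr 1
    rw [Finset.sum_congr rfl (g := fun _ => φ m)]
    · simp
    · intro s hs
      rw [Nat.mul_add_div hR, Nat.div_eq_of_lt (Finset.mem_range.1 hs), add_zero]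

theorem sum_forest_le {n N : ℕ} {x : ℕ → ℕ} {f : ℕ → BinTree}
    (hf : ∀ i ≤ n, ∑ v ∈ Finset.range N, leafCount (f v) i ≤ x i)
    (hf' : ∀ i > n, ∑ v ∈ Finset.range N, leafCount (f v) i = 0) (m : ℕ) :
    ∑ v ∈ Finset.range N, ∑ i ∈ Finset.range m, leafCount (f v) i ≤
      ∑ i ∈ Finset.range (n + 1), x i := by
  rw [Finset.sum_comm]
  calc _ ≤ ∑ i ∈ Finset.range (n + 1), ∑ v ∈ Finset.range N, leafCount (f v) i := by
        refine Finset.sum_le_sum_of_ne_zero fun i _ hi => ?_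
        by_contra hin
        exact hi (hf' i (by simpa using hin))
    _ ≤ _ := Finset.sum_le_sum fun i hi => hf i (by have := Finset.mem_range.1 hi; omega)

section

variable {k d R M : ℕ} {D g G : ℝ} {u : ℕ → ℝ}

theorem profile_nonneg (hD : 0 ≤ D) (hu : ∀ n, 0 < u n) (n t : ℕ) : 0 ≤ profile D R M u n t := by
  unfold profile
  split_ifs
  · have := hu n
    have := hu (n - t / R)
    positivity
  · exact le_rfl

/-- Ages `0` and `1` are concentrated by at most `g`, which will be close to `1`. Older leaves may
reach the large constant `G`, but their number is exponentially small. -/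
theorem profile_le (hD : 0 ≤ D) (hu : ∀ n, 0 < u n) (hanti : Antitone u) {n : ℕ}
    (hg : u (n - 1) / u n ≤ g) (hG : u (n - M) / u n ≤ G) (t : ℕ) :
    profile D R M u n t ≤ D / 2 ^ (t + 1) * (g + if 2 * R ≤ t then G else 0) := by
  have hg₀ : 0 ≤ g := (div_pos (hu _) (hu _)).le.trans hg
  have hG₀ : 0 ≤ G := (div_pos (hu _) (hu _)).le.trans hG
  unfold profile
  split_ifs with h₁ h₂ h₂
  · gcongr
    have hle : t / R ≤ M := Nat.lt_succ_iff.1 (Nat.div_lt_of_lt_mul h₁)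
    have : u (n - t / R) / u n ≤ u (n - M) / u n :=
      div_le_div_of_nonneg_right (hanti (by omega)) (hu n).le
    linarith
  · gcongr
    have hle : t / R ≤ 1 := Nat.lt_succ_iff.1 (Nat.div_lt_of_lt_mul (by linarith))
    have : u (n - t / R) / u n ≤ u (n - 1) / u n :=
      div_le_div_of_nonneg_right (hanti (by omega)) (hu n).le
    linarith
  · positivity
  · positivity

/-- Leaf numbers grow geometrically with the distance, so the recent ages dominate. Leaves of age at
least `2` total at most `D * G / 2 ^ (2 * R)`, and there are `2 ^ h ≤ 2 ^ R` copies. -/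
theorem two_pow_mul_sum_profile_le (hD : 0 ≤ D) (hk : 2 * R ≤ k) (hu : ∀ n, 0 < u n)
    (hanti : Antitone u) {n : ℕ} (hg : u (n - 1) / u n ≤ g) (hG : u (n - M) / u n ≤ G) {h : ℕ}
    (hh : h ≤ R) :
    2 ^ h * ∑ i ∈ Finset.range (k - h), profile D R M u n (k - 1 - i) ≤ D * (g + G / 2 ^ R) := by
  have hg₀ : 0 ≤ g := (div_pos (hu _) (hu _)).le.trans hg
  have hG₀ : 0 ≤ G := (div_pos (hu _) (hu _)).le.trans hG
  have h₁ : ∑ i ∈ Finset.range (k - h), profile D R M u n (k - 1 - i) ≤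
      ∑ i ∈ Finset.range (k - h), D / 2 ^ k * g * 2 ^ i +
        ∑ i ∈ Finset.range (k - h), if i < k - 2 * R then D / 2 ^ k * G * 2 ^ i else 0 := by
    rw [← Finset.sum_add_distrib]
    refine Finset.sum_le_sum fun i hi => ?_
    have hi' := Finset.mem_range.1 hi
    refine (profile_le hD hu hanti hg hG _).trans_eq ?_
    have hpow : D / 2 ^ (k - 1 - i + 1) = D / 2 ^ k * 2 ^ i := by
      have : (2 : ℝ) ^ k = 2 ^ (k - 1 - i + 1) * 2 ^ i := by rw [← pow_add]; congr 1; omega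
      rw [this]; field_simp
    rw [hpow]
    by_cases hc : i < k - 2 * R
    · rw [if_pos hc, if_pos (by omega)]; ring
    · rw [if_neg hc, if_neg (by omega)]; ring
  have h₂ : ∑ i ∈ Finset.range (k - h), (if i < k - 2 * R then D / 2 ^ k * G * 2 ^ i else 0) ≤
      ∑ i ∈ Finset.range (k - 2 * R), D / 2 ^ k * G * 2 ^ i := by
    rw [← Finset.sum_filter]
    refine Finset.sum_le_sum_of_subset_of_nonneg ?_ fun _ _ _ => by positivity
    intro i hi
    exact Finset.mem_range.2 (Finset.mem_filter.1 hi).2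
  rw [← Finset.mul_sum] at h₁ h₂
  have h₃ := mul_le_mul_of_nonneg_left (sum_two_pow_le (k - h))
    (by positivity : 0 ≤ D / 2 ^ k * g)
  have h₄ := mul_le_mul_of_nonneg_left (sum_two_pow_le (k - 2 * R))
    (by positivity : 0 ≤ D / 2 ^ k * G)
  have e₁ : (2 : ℝ) ^ h * (D / 2 ^ k * g * 2 ^ (k - h)) = D * g := by
    have : (2 : ℝ) ^ k = 2 ^ h * 2 ^ (k - h) := by rw [← pow_add]; congr 1; omega
    rw [this]; field_simp
  have e₂ : (2 : ℝ) ^ R * (D / 2 ^ k * G * 2 ^ (k - 2 * R)) = D * (G / 2 ^ R) := by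
    have : (2 : ℝ) ^ k = 2 ^ R * 2 ^ R * 2 ^ (k - 2 * R) := by
      rw [← pow_add, ← pow_add]; congr 1; omega
    rw [this]; field_simp
  calc 2 ^ h * ∑ i ∈ Finset.range (k - h), profile D R M u n (k - 1 - i)
      ≤ 2 ^ h * (D / 2 ^ k * g * 2 ^ (k - h) + D / 2 ^ k * G * 2 ^ (k - 2 * R)) := by
        gcongr; linarith
    _ = 2 ^ h * (D / 2 ^ k * g * 2 ^ (k - h)) + 2 ^ h * (D / 2 ^ k * G * 2 ^ (k - 2 * R)) := by
        ring
    _ ≤ 2 ^ h * (D / 2 ^ k * g * 2 ^ (k - h)) + 2 ^ R * (D / 2 ^ k * G * 2 ^ (k - 2 * R)) := by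
        gcongr
        norm_num
    _ = D * (g + G / 2 ^ R) := by rw [e₁, e₂]; ring

theorem sum_oldest_le (hD : 0 ≤ D) (hM : 1 ≤ M) (hu : ∀ n, 0 < u n)
    (hanti : Antitone u) {n m : ℕ} (hk : k = m + 1 + R + R * M) (hG : u (n - M) / u n ≤ G) :
    ∑ i ∈ Finset.range (m + 1), profile D R M u n (k - 1 - R - i) ≤ D * (G / 2 ^ R) := by
  have hG₀ : 0 ≤ G := (div_pos (hu _) (hu _)).le.trans hG
  have h₁ : ∀ i ∈ Finset.range (m + 1), profile D R M u n (k - 1 - R - i) ≤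
      D * G / 2 ^ (k - R) * 2 ^ i := by
    intro i hi
    have hi' := Finset.mem_range.1 hi
    have hpow : D / 2 ^ (k - 1 - R - i + 1) = D / 2 ^ (k - R) * 2 ^ i := by
      have : (2 : ℝ) ^ (k - R) = 2 ^ (k - 1 - R - i + 1) * 2 ^ i := by
        rw [← pow_add]; congr 1; omega
      rw [this]; field_simp
    unfold profile
    split_ifs with h
    · have hle : (k - 1 - R - i) / R ≤ M := Nat.lt_succ_iff.1 (Nat.div_lt_of_lt_mul h)
      have : u (n - (k - 1 - R - i) / R) / u n ≤ u (n - M) / u n :=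
        div_le_div_of_nonneg_right (hanti (by omega)) (hu n).le
      rw [hpow]
      calc _ ≤ D / 2 ^ (k - R) * 2 ^ i * G := by gcongr; linarith
        _ = _ := by ring
    · positivity
  refine (Finset.sum_le_sum h₁).trans ?_
  rw [← Finset.mul_sum]
  calc D * G / 2 ^ (k - R) * ∑ i ∈ Finset.range (m + 1), (2 : ℝ) ^ i
      ≤ D * G / 2 ^ (k - R) * 2 ^ (m + 1) := by gcongr; exact sum_two_pow_le _
    _ = D * (G / 2 ^ (R * M)) := by
        have : (2 : ℝ) ^ (k - R) = 2 ^ (m + 1) * 2 ^ (R * M) := by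
          rw [← pow_add]; congr 1; omega
        rw [this]; field_simp
    _ ≤ D * (G / 2 ^ R) := by
        gcongr
        · norm_num
        · exact Nat.le_mul_of_pos_right _ hM

/-- One generation: `a` of the `2 ^ R` descendants at depth `R` are finished with the oldest leaves,
the others share the remaining leaves equally. -/
theorem constructible_of_succ {β : ℝ} (hβ : 0 ≤ β) (hDβ : D = β * 2 ^ k) (hR : 0 < R) (hM : 1 ≤ M)
    (hk : 2 * R + 1 + R * M ≤ k) (hu : ∀ n, 0 < u n) (hanti : Antitone u) {n a : ℕ} (hn : M ≤ n)
    (hg : u (n + 1 - 1) / u (n + 1) ≤ g) (hG : u (n - M) / u n ≤ G)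
    (hG' : u (n + 1 - M) / u (n + 1) ≤ G) (ha : a < 2 ^ R)
    (hua : u (n + 1) = u n * (1 - a / 2 ^ R)) (hd : D * (g + 2 * G / 2 ^ R) ≤ d)
    (hrate : (a + 1 : ℝ) ≤ R * β * 2 ^ R * (u (n - M) / u n))
    (hT : Constructible k d (profile D R M u (n + 1))) :
    Constructible k d (profile D R M u n) := by
  obtain ⟨T, hsparse, hcount⟩ := hT
  have hD : 0 ≤ D := by rw [hDβ]; positivity
  have hG₀ : 0 ≤ G := (div_pos (hu _) (hu _)).le.trans hG
  have hg₀ : 0 ≤ g := (div_pos (hu _) (hu _)).le.trans hg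
  obtain ⟨m, hkm⟩ : ∃ m, k = m + 1 + R + R * M := ⟨k - (1 + R + R * M), by omega⟩
  have hmR : R ≤ m := by omega
  -- The `R` levels of age `M` have equal Kraft weight, as the profile halves when the weight
  -- doubles. The `+ 1` in `hrate` pays for rounding, since `2 ^ R ≤ 2 ^ m`.
  have hkraft : a * 2 ^ m ≤ ∑ i ∈ Finset.range (m + 1),
      ⌊profile D R M u n (k - 1 - R - i)⌋₊ * 2 ^ (m - i) := by
    have h := le_sum_floor_mul_two_pow (fun i => profile D R M u n (k - 1 - R - i))
      (show R ≤ m + 1 by omega)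
    have hterm : ∀ s ∈ Finset.range R, profile D R M u n (k - 1 - R - (m - s)) * 2 ^ s =
        D / 2 ^ (R * M + 1) * (u (n - M) / u n) := by
      intro s hs
      have hs' := Finset.mem_range.1 hs
      have hidx : k - 1 - R - (m - s) = R * M + s := by omega
      rw [hidx, profile, if_pos (by rw [mul_add, mul_one]; omega), Nat.mul_add_div hR,
        Nat.div_eq_of_lt hs', add_zero]
      have : (2 : ℝ) ^ (R * M + s + 1) = 2 ^ (R * M + 1) * 2 ^ s := by
        rw [← pow_add]; congr 1; omega
      rw [this]
      field_simp
    rw [Finset.sum_congr rfl hterm, Finset.sum_const, Finset.card_range, nsmul_eq_mul] at h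
    have hpow : (2 : ℝ) ^ k = 2 ^ m * 2 ^ R * 2 ^ (R * M + 1) := by
      rw [← pow_add, ← pow_add]; congr 1; omega
    have hD' : D / 2 ^ (R * M + 1) = β * 2 ^ R * 2 ^ m := by
      rw [hDβ, hpow]; field_simp
    rw [hD'] at h
    have h₂ : (2 : ℝ) ^ R ≤ 2 ^ m := pow_le_pow_right₀ (by norm_num) hmR
    have h₃ := mul_le_mul_of_nonneg_right hrate (by positivity : (0 : ℝ) ≤ 2 ^ m)
    have h₄ : ((a * 2 ^ m : ℕ) : ℝ) ≤ ((∑ i ∈ Finset.range (m + 1),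
      ⌊profile D R M u n (k - 1 - R - i)⌋₊ * 2 ^ (m - i) : ℕ) : ℝ) := by
      refine le_trans ?_ h
      push_cast
      nlinarith
    exact_mod_cast h₄
  obtain ⟨f, hf, hf'⟩ := exists_forest hkraft
  have hold : ((∑ i ∈ Finset.range (m + 1), ⌊profile D R M u n (k - 1 - R - i)⌋₊ : ℕ) : ℝ) ≤
      D * (G / 2 ^ R) := by
    rw [Nat.cast_sum]
    refine (Finset.sum_le_sum fun i _ => Nat.floor_le (profile_nonneg hD hu _ _)).trans ?_
    exact sum_oldest_le hD hM hu hanti hkm hG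
  have hnew : ∀ j ≤ R, ((2 ^ j * ∑ i ∈ Finset.range (k - j), leafCount T i : ℕ) : ℝ) ≤
      D * (g + G / 2 ^ R) := by
    intro j hj
    refine le_trans ?_ (two_pow_mul_sum_profile_le (k := k) hD (by omega) hu hanti hg hG' hj)
    push_cast
    gcongr with i hi
    have hi' := Finset.mem_range.1 hi
    exact (Nat.cast_le.2 (hcount i (by omega))).trans (Nat.floor_le (profile_nonneg hD hu _ _))
  -- The leaves of all finished trees are so few that they are charged in full to every node.
  have hcap : ∀ j ≤ R, ∑ i ∈ Finset.range (m + 1), ⌊profile D R M u n (k - 1 - R - i)⌋₊ +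
      2 ^ j * ∑ i ∈ Finset.range (k - j), leafCount T i ≤ d := by
    intro j hj
    have h₁ := hnew j hj
    have h₂ : D * (g + 2 * G / 2 ^ R) = D * (G / 2 ^ R) + D * (g + G / 2 ^ R) := by ring
    have h₃ : ((∑ i ∈ Finset.range (m + 1), ⌊profile D R M u n (k - 1 - R - i)⌋₊ +
      2 ^ j * ∑ i ∈ Finset.range (k - j), leafCount T i : ℕ) : ℝ) ≤ d := by
      rw [Nat.cast_add]; linarith
    exact_mod_cast h₃
  refine ⟨complete R fun v => if v < a then f v else T, sparse_complete ?_ ?_, ?_⟩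
  · intro v
    split_ifs with hv
    · exact sparse_of_forest hf hf' (le_trans (Nat.le_add_right _ _) (hcap 0 (Nat.zero_le _))) hv
    · exact hsparse
  · intro j hj o
    refine le_trans ?_ (hcap j hj)
    let φ : ℕ → ℕ := fun w => if w < a then ∑ i ∈ Finset.range (k - j), leafCount (f w) i else 0
    calc _ ≤ ∑ v ∈ Finset.range (2 ^ j),
          (φ (o + v) + ∑ i ∈ Finset.range (k - j), leafCount T i) := by
          refine Finset.sum_le_sum fun v _ => ?_
          simp only [φ]
          split_ifs <;> omega
      _ = ∑ v ∈ Finset.range (2 ^ j), φ (o + v) +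
          2 ^ j * ∑ i ∈ Finset.range (k - j), leafCount T i := by
          rw [Finset.sum_add_distrib, Finset.sum_const, Finset.card_range, smul_eq_mul]
      _ ≤ _ := by
          gcongr
          calc ∑ v ∈ Finset.range (2 ^ j), φ (o + v) ≤ ∑ v ∈ Finset.range (o + 2 ^ j), φ v := by
                rw [Finset.sum_range_add]; omega
            _ ≤ ∑ v ∈ Finset.range a, φ v := by
                refine Finset.sum_le_sum_of_ne_zero fun w _ hw => ?_
                by_contra hwa
                exact hw (if_neg (by simpa using hwa))
            _ = ∑ v ∈ Finset.range a, ∑ i ∈ Finset.range (k - j), leafCount (f v) i :=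
                Finset.sum_congr rfl fun v hv => if_pos (Finset.mem_range.1 hv)
            _ ≤ _ := sum_forest_le hf hf' _
  · intro i' hi'
    rcases lt_or_ge i' R with hlt | hge
    · rw [leafCount_complete_of_lt _ hlt]; exact Nat.zero_le _
    obtain ⟨i, rfl⟩ := Nat.exists_eq_add_of_le' hge
    have hsplit : ∑ v ∈ Finset.range (2 ^ R), leafCount (if v < a then f v else T) i =
        ∑ v ∈ Finset.range a, leafCount (f v) i + (2 ^ R - a) * leafCount T i := by
      rw [← Finset.sum_range_add_sum_Ico _ ha.le]
      congr 1
      · exact Finset.sum_congr rfl fun v hv => by rw [if_pos (Finset.mem_range.1 hv)]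
      · rw [Finset.sum_congr rfl (g := fun _ => leafCount T i)]
        · simp
        · intro v hv
          rw [if_neg (by have := (Finset.mem_Ico.1 hv).1; omega)]
    rw [leafCount_complete, hsplit]
    have hT := hcount i (by omega)
    -- Beyond level `m` only the `2 ^ R - a` copies of `T` have leaves, and sharing equally turns
    -- one profile into the next. Up to level `m`, leaves of `T` would have age above `M`, so only
    -- finished trees contribute.
    rcases lt_or_ge m i with him | him
    · rw [hf' i him, zero_add]
      refine Nat.le_floor ?_
      have ht : k - 1 - i = k - 1 - (i + R) + R := by omega
      have hstep : ((2 ^ R - a : ℕ) : ℝ) * profile D R M u (n + 1) (k - 1 - i) =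
          profile D R M u n (k - 1 - (i + R)) := by
        have htM : k - 1 - (i + R) < R * M := by omega
        rw [ht]
        generalize k - 1 - (i + R) = t at htM
        have hdiv : t / R < M := Nat.div_lt_of_lt_mul htM
        rw [profile, profile, if_pos (by rw [mul_add, mul_one]; omega),
          if_pos (by rw [mul_add, mul_one]; omega), Nat.add_div_right _ hR, hua,
          show n + 1 - (t / R).succ = n - t / R by omega, Nat.cast_sub ha.le]
        push_cast
        have hpos : (0 : ℝ) < 2 ^ R - a := by
          rw [sub_pos]; exact_mod_cast ha
        have hun := hu n
        have : (1 : ℝ) - a / 2 ^ R = (2 ^ R - a) / 2 ^ R := by field_simp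
        rw [this, show t + R + 1 = (t + 1) + R by omega, pow_add 2 (t + 1) R]
        field_simp
      rw [← hstep]
      push_cast
      gcongr
      exact (Nat.cast_le.2 hT).trans (Nat.floor_le (profile_nonneg hD hu _ _))
    · have hzero : profile D R M u (n + 1) (k - 1 - i) = 0 := by
        rw [profile, if_neg]
        rw [mul_add, mul_one]; omega
      rw [hzero, Nat.floor_zero, Nat.le_zero] at hT
      rw [hT, mul_zero, add_zero, show k - 1 - (i + R) = k - 1 - R - i by omega]
      exact hf i him

/-- The last generation: the leaves of all ages have enough Kraft weight for one whole tree. Weight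
`1` would suffice without rounding; the bound `2` absorbs it. -/
theorem constructible_of_weight {β : ℝ} (hβ : 0 ≤ β) (hDβ : D = β * 2 ^ k) (hR : 0 < R)
    (hk : 2 * R + 1 + R * M ≤ k) (hu : ∀ n, 0 < u n) (hanti : Antitone u) {n : ℕ}
    (hg : u (n - 1) / u n ≤ g) (hG : u (n - M) / u n ≤ G) (hd : D * (g + 2 * G / 2 ^ R) ≤ d)
    (hweight : 2 ≤ R * β * ∑ j ∈ Finset.range (M + 1), u (n - j) / u n) :
    Constructible k d (profile D R M u n) := by
  have hD : 0 ≤ D := by rw [hDβ]; positivity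
  have hG₀ : 0 ≤ G := (div_pos (hu _) (hu _)).le.trans hG
  have hcap : ∑ i ∈ Finset.range (k - 1 + 1), ⌊profile D R M u n (k - 1 - i)⌋₊ ≤ d := by
    have h := two_pow_mul_sum_profile_le (k := k) hD (by omega) hu hanti hg hG (Nat.zero_le R)
    rw [pow_zero, one_mul, Nat.sub_zero] at h
    have h₁ : ((∑ i ∈ Finset.range (k - 1 + 1), ⌊profile D R M u n (k - 1 - i)⌋₊ : ℕ) : ℝ) ≤ d := by
      rw [Nat.sub_add_cancel (by omega), Nat.cast_sum]
      refine (Finset.sum_le_sum fun i _ => Nat.floor_le (profile_nonneg hD hu _ _)).trans ?_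
      refine h.trans (le_trans ?_ hd)
      gcongr
      linarith
    exact_mod_cast h₁
  have hkraft : 1 * 2 ^ (k - 1) ≤ ∑ i ∈ Finset.range (k - 1 + 1),
      ⌊profile D R M u n (k - 1 - i)⌋₊ * 2 ^ (k - 1 - i) := by
    have hL : R * (M + 1) ≤ k - 1 := by rw [mul_add, mul_one]; omega
    have h := le_sum_floor_mul_two_pow (fun i => profile D R M u n (k - 1 - i))
      (show R * (M + 1) ≤ k - 1 + 1 by omega)
    have hterm : ∀ s ∈ Finset.range (R * (M + 1)), profile D R M u n (k - 1 - (k - 1 - s)) * 2 ^ s =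
        D / 2 * (u (n - s / R) / u n) := by
      intro s hs
      have hs' := Finset.mem_range.1 hs
      rw [Nat.sub_sub_self (by omega), profile, if_pos hs', pow_succ]
      field_simp
    rw [Finset.sum_congr rfl hterm, ← Finset.mul_sum,
      sum_range_mul_div R (M + 1) (fun j => u (n - j) / u n) hR] at h
    have hpow : (2 : ℝ) ^ k = 2 ^ (k - 1) * 2 := by rw [← pow_succ]; congr 1; omega
    have h₂ : (2 : ℝ) ^ (R * (M + 1)) ≤ 2 ^ (k - 1) := pow_le_pow_right₀ (by norm_num) hL
    have h₃ := mul_le_mul_of_nonneg_right hweight (by positivity : (0 : ℝ) ≤ 2 ^ (k - 1))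
    have h₄ : ((1 * 2 ^ (k - 1) : ℕ) : ℝ) ≤ ((∑ i ∈ Finset.range (k - 1 + 1),
      ⌊profile D R M u n (k - 1 - i)⌋₊ * 2 ^ (k - 1 - i) : ℕ) : ℝ) := by
      refine le_trans ?_ h
      rw [hDβ, hpow]
      push_cast
      nlinarith
    exact_mod_cast h₄
  obtain ⟨f, hf, hf'⟩ := exists_forest hkraft
  refine ⟨f 0, sparse_of_forest hf hf' hcap one_pos, fun i hi => ?_⟩
  simpa using hf i (by omega)

/-- The top of the tree: with nothing finished yet, leaf numbers at most double per level, so `2 ^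
j` copies seen to depth `k - j` hold at most `D` leaves. A complete tree of height `k` above pushes
all leaves to depth `k`. -/
theorem exists_sparse_of_constructible (hD : 0 ≤ D) (hDd : D ≤ d) {n : ℕ} (hu : ∀ i ≤ n, u i = 1)
    (h : Constructible k d (profile D R M u n)) :
    ∃ T : BinTree, T.Sparse k d ∧ ∀ i < k, T.leafCount i = 0 := by
  obtain ⟨T, hsparse, hcount⟩ := h
  refine ⟨complete k fun _ => T, sparse_complete (fun _ => hsparse) fun j hj o => ?_,
    fun i hi => leafCount_complete_of_lt _ hi⟩
  have hterm : ∀ i ∈ Finset.range (k - j), (leafCount T i : ℝ) ≤ D / 2 ^ k * 2 ^ i := by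
    intro i hi
    have hi' := Finset.mem_range.1 hi
    have hle : profile D R M u n (k - 1 - i) ≤ D / 2 ^ k * 2 ^ i := by
      unfold profile
      split_ifs
      · rw [hu _ (Nat.sub_le _ _), hu n le_rfl]
        have : (2 : ℝ) ^ k = 2 ^ (k - 1 - i + 1) * 2 ^ i := by rw [← pow_add]; congr 1; omega
        rw [this]
        apply le_of_eq
        field_simp
      · positivity
    exact (Nat.cast_le.2 ((hcount i (by omega)).trans (Nat.floor_le_floor hle))).trans
      (Nat.floor_le (by positivity))
  have hsum : ((2 ^ j * ∑ i ∈ Finset.range (k - j), leafCount T i : ℕ) : ℝ) ≤ d := by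
    push_cast
    calc (2 : ℝ) ^ j * ∑ i ∈ Finset.range (k - j), (leafCount T i : ℝ)
        ≤ 2 ^ j * (D / 2 ^ k * 2 ^ (k - j)) := by
          gcongr
          refine (Finset.sum_le_sum hterm).trans ?_
          rw [← Finset.mul_sum]
          gcongr
          exact sum_two_pow_le _
      _ = D := by
          have : (2 : ℝ) ^ k = 2 ^ j * 2 ^ (k - j) := by rw [← pow_add]; congr 1; omega
          rw [this]; field_simp
      _ ≤ d := hDd
  rw [Finset.sum_const, Finset.card_range, smul_eq_mul]
  exact_mod_cast hsum

end

/-! ### Decay of the unfinished fraction -/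

/-- The fraction of nodes unfinished in generation `n` when the finishing rate is raised by `2⁻ᴿ`
every `M` generations, up to `A / 2 ^ R`. -/
noncomputable def unfinished (R M A : ℕ) : ℕ → ℝ
  | 0 => 1
  | n + 1 => unfinished R M A n * (1 - (min (n / M) A : ℕ) / 2 ^ R)

section

variable {R M A : ℕ}

theorem unfinished_pos (hA : A < 2 ^ R) (n : ℕ) : 0 < unfinished R M A n := by
  induction n with
  | zero => exact one_pos
  | succ n ih =>
    refine mul_pos ih ?_
    rw [sub_pos, div_lt_one (by positivity)]
    exact_mod_cast (min_le_right _ _).trans_lt hA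

theorem antitone_unfinished (hA : A < 2 ^ R) : Antitone (unfinished R M A) := by
  refine antitone_nat_of_succ_le fun n => ?_
  refine mul_le_of_le_one_right (unfinished_pos hA n).le ?_
  rw [sub_le_self_iff]
  positivity

theorem unfinished_eq_one {n : ℕ} (hn : n ≤ M) : unfinished R M A n = 1 := by
  induction n with
  | zero => rfl
  | succ n ih => simp [unfinished, ih (by omega), Nat.div_eq_of_lt (by omega : n < M)]

/-- Iterates `1 - y ≤ e ^ (-y)`. Fast decay is what the Kraft conditions require. -/
theorem unfinished_mul_exp_le (hA : A < 2 ^ R) {c : ℝ} (m j : ℕ)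
    (hc : ∀ i, m ≤ i → i < m + j → c ≤ (min (i / M) A : ℕ) / 2 ^ R) :
    unfinished R M A (m + j) * Real.exp (c * j) ≤ unfinished R M A m := by
  induction j with
  | zero => simp
  | succ j ih =>
    have h₁ := ih fun i hi hi' => hc i hi (by omega)
    have h₂ := hc (m + j) (by omega) (by omega)
    have h₃ : (1 - ((min ((m + j) / M) A : ℕ) : ℝ) / 2 ^ R) * Real.exp c ≤ 1 := by
      have h₄ : 1 - ((min ((m + j) / M) A : ℕ) : ℝ) / 2 ^ R ≤ Real.exp (-c) := by
        linarith [Real.add_one_le_exp (-c)]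
      calc _ ≤ Real.exp (-c) * Real.exp c := by gcongr
        _ = 1 := by rw [← Real.exp_add, neg_add_cancel, Real.exp_zero]
    have hpos := unfinished_pos (M := M) hA (m + j)
    rw [← add_assoc, unfinished]
    calc unfinished R M A (m + j) * (1 - ((min ((m + j) / M) A : ℕ) : ℝ) / 2 ^ R) *
          Real.exp (c * (j + 1 : ℕ))
        = unfinished R M A (m + j) * Real.exp (c * j) *
          ((1 - ((min ((m + j) / M) A : ℕ) : ℝ) / 2 ^ R) * Real.exp c) := by
          push_cast; rw [mul_add, mul_one, Real.exp_add]; ring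
      _ ≤ unfinished R M A (m + j) * Real.exp (c * j) * 1 := by gcongr
      _ ≤ _ := by rw [mul_one]; exact h₁

/-- Iterates `(1 - c) * (1 + 2 * c) ≥ 1` on `[0, 1 / 2]`; it bounds the concentration `G`. -/
theorem unfinished_le_mul_exp (hA : A < 2 ^ R) {c : ℝ} (hc : (A : ℝ) / 2 ^ R ≤ c) (hc' : c ≤ 1 / 2)
    (m j : ℕ) : unfinished R M A m ≤ unfinished R M A (m + j) * Real.exp (2 * c * j) := by
  induction j with
  | zero => simp
  | succ j ih =>
    have h₀ : 0 ≤ (A : ℝ) / 2 ^ R := by positivity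
    have hmin : ((min ((m + j) / M) A : ℕ) : ℝ) / 2 ^ R ≤ c := by
      refine le_trans ?_ hc
      gcongr
      exact min_le_right _ _
    have h₃ : 1 ≤ (1 - ((min ((m + j) / M) A : ℕ) : ℝ) / 2 ^ R) * Real.exp (2 * c) := by
      calc (1 : ℝ) ≤ (1 - c) * (1 + 2 * c) := by nlinarith
        _ ≤ _ := mul_le_mul (by linarith) (by linarith [Real.add_one_le_exp (2 * c)])
          (by linarith) (by linarith)
    have hpos := unfinished_pos (M := M) hA (m + j)
    rw [← add_assoc, unfinished]
    calc unfinished R M A m ≤ unfinished R M A (m + j) * Real.exp (2 * c * j) * 1 := by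
          rw [mul_one]; exact ih
      _ ≤ unfinished R M A (m + j) * Real.exp (2 * c * j) *
          ((1 - ((min ((m + j) / M) A : ℕ) : ℝ) / 2 ^ R) * Real.exp (2 * c)) := by gcongr
      _ = _ := by push_cast; rw [mul_add, mul_one, Real.exp_add]; ring

theorem unfinished_div_succ_le (hA : A < 2 ^ R) {c : ℝ} (hc : (A : ℝ) / 2 ^ R ≤ c)
    (hc' : c ≤ 1 / 2) (n : ℕ) : unfinished R M A n / unfinished R M A (n + 1) ≤ 1 + 2 * c := by
  have h₀ : 0 ≤ (A : ℝ) / 2 ^ R := by positivity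
  have hmin : ((min (n / M) A : ℕ) : ℝ) / 2 ^ R ≤ c := by
    refine le_trans ?_ hc
    gcongr
    exact min_le_right _ _
  have hpos := unfinished_pos (M := M) hA n
  rw [div_le_iff₀ (unfinished_pos hA _), unfinished]
  have : 1 ≤ (1 + 2 * c) * (1 - ((min (n / M) A : ℕ) : ℝ) / 2 ^ R) := by
    calc (1 : ℝ) ≤ (1 + 2 * c) * (1 - c) := by nlinarith
      _ ≤ _ := by gcongr; linarith
  nlinarith

end

/-! ### Choice of parameters and existence of the tree -/

theorem mul_const_le_two_pow {R : ℕ} (hR : 30 ≤ R) : R * 131072 ≤ 2 ^ R := by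
  induction R, hR using Nat.le_induction with
  | base => norm_num
  | succ R hR ih => rw [pow_succ 2 R]; linarith

theorem sq_le_two_pow {R : ℕ} (hR : 4 ≤ R) : R * R ≤ 2 ^ R := by
  induction R, hR using Nat.le_induction with
  | base => norm_num
  | succ R hR ih => rw [pow_succ 2 R]; nlinarith

/-- Generations are treated from the last, `M * A + M`, back to `M`, where `u` is still `1`. `M = R
- 3` makes the window fit: `2 * R + 1 + R * M ≤ R * R`. The term `11 / M` is `10 / M` from `g` plus
`1 / M` for the part with `G = e ^ 10`. -/
theorem exists_sparse_tree {R k d : ℕ} (hR : 30 ≤ R) (hk : R * R ≤ k)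
    (hd : Real.exp (-1 + 2 / R) / (R * (R - 3)) * 2 ^ k * (1 + 11 / (R - 3)) ≤ d) :
    ∃ T : BinTree, T.Sparse k d ∧ ∀ i < k, T.leafCount i = 0 := by
  obtain ⟨M, rfl⟩ : ∃ M, R = M + 3 := ⟨R - 3, by omega⟩
  set R := M + 3 with hRM
  have hMcast : (R : ℝ) - 3 = M := by rw [hRM]; push_cast; ring
  rw [hMcast] at hd
  have hM : (27 : ℝ) ≤ M := by exact_mod_cast (by omega : 27 ≤ M)
  have hM₀ : (0 : ℝ) < M := by linarith
  have hR₀ : (0 : ℝ) < R := by exact_mod_cast (by omega : 0 < R)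
  have hMR : (M : ℝ) ≤ R := by linarith
  have hQ : (R : ℝ) * R ≤ 2 ^ R := by exact_mod_cast sq_le_two_pow (by omega : 4 ≤ R)
  have hQ₀ : (0 : ℝ) < 2 ^ R := by positivity
  -- The final rate is about `4 / M`, so that the ages `j ≤ M` weigh at least `∑ 4 j / M ^ 2 ≥ 2` in
  -- total.
  set A := ⌈4 * (2 : ℝ) ^ R / M⌉₊ with hAdef
  have hA₁ : 4 / (M : ℝ) ≤ A / 2 ^ R := by
    rw [le_div_iff₀ hQ₀, div_mul_eq_mul_div]
    exact Nat.le_ceil _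
  have hA₂ : (A : ℝ) / 2 ^ R ≤ 5 / M := by
    rw [div_le_iff₀ hQ₀]
    refine (Nat.ceil_lt_add_one (by positivity)).le.trans ?_
    rw [div_mul_eq_mul_div, div_add_one hM₀.ne']
    gcongr
    nlinarith
  have hc : 5 / (M : ℝ) ≤ 1 / 2 := by
    rw [div_le_div_iff₀ hM₀ two_pos]; linarith
  have hA : A < 2 ^ R := by
    have : (A : ℝ) < 2 ^ R := by rw [← div_lt_one hQ₀]; linarith
    exact_mod_cast this
  set u := unfinished R M A with hu
  set β := Real.exp (-1 + 2 / R) / (R * M) with hβ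
  have hβ₀ : 0 ≤ β := by positivity
  have hRβ : R * β = Real.exp (-1 + 2 / R) / M := by rw [hβ]; field_simp
  have hupos : ∀ n, 0 < u n := unfinished_pos hA
  have hanti : Antitone u := antitone_unfinished hA
  have hg : ∀ n, M ≤ n → u (n - 1) / u n ≤ 1 + 2 * (5 / M) := by
    intro n hn
    obtain ⟨n, rfl⟩ := Nat.exists_eq_succ_of_ne_zero (by omega : n ≠ 0)
    exact unfinished_div_succ_le hA hA₂ hc n
  have hG : ∀ n, M ≤ n → u (n - M) / u n ≤ Real.exp 10 := by
    intro n hn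
    obtain ⟨n, rfl⟩ := Nat.exists_eq_add_of_le' hn
    rw [Nat.add_sub_cancel, div_le_iff₀ (hupos _), mul_comm]
    have h := unfinished_le_mul_exp (M := M) hA hA₂ hc n M
    have e : 2 * (5 / (M : ℝ)) * M = 10 := by field_simp; norm_num
    rwa [e] at h
  have hd' : β * 2 ^ k * (1 + 2 * (5 / M) + 2 * Real.exp 10 / 2 ^ R) ≤ d := by
    refine le_trans (mul_le_mul_of_nonneg_left ?_ (by positivity)) hd
    have h₁ : Real.exp 10 ≤ 2 ^ 16 := by
      have : Real.exp 10 = Real.exp 1 ^ 10 := by rw [← Real.exp_nat_mul]; norm_num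
      rw [this]
      calc Real.exp 1 ^ 10 ≤ 3 ^ 10 := by
            gcongr
            linarith [Real.exp_one_lt_d9]
        _ ≤ 2 ^ 16 := by norm_num
    have h₂ : (R : ℝ) * 131072 ≤ 2 ^ R := by exact_mod_cast mul_const_le_two_pow hR
    have h₃ : 2 * Real.exp 10 / 2 ^ R ≤ 1 / M := by
      rw [div_le_div_iff₀ hQ₀ hM₀]
      nlinarith
    have h₄ : (11 : ℝ) / M = 2 * (5 / M) + 1 / M := by ring
    linarith
  have hkM : 2 * R + 1 + R * M ≤ k := by
    have : R * R = R * M + R * 3 := by rw [← mul_add]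
    omega
  have hlast : Constructible k d (profile (β * 2 ^ k) R M u (M * A + M)) := by
    refine constructible_of_weight hβ₀ rfl (by omega) hkM hupos hanti (hg _ (by omega))
      (hG _ (by omega)) hd' ?_
    rw [hRβ, Finset.mul_sum]
    have hterm : ∀ j ∈ Finset.range (M + 1), 4 / (M * M : ℝ) * j ≤
        Real.exp (-1 + 2 / R) / M * (u (M * A + M - j) / u (M * A + M)) := by
      intro j hj
      have hj' : j ≤ M := Nat.lt_succ_iff.1 (Finset.mem_range.1 hj)
      have h₁ := unfinished_mul_exp_le (M := M) hA (c := A / 2 ^ R) (M * A + M - j) j (by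
        intro i hi hi'
        have : A ≤ i / M := by
          rw [Nat.le_div_iff_mul_le (by omega), mul_comm]; omega
        rw [min_eq_right this])
      rw [Nat.sub_add_cancel (by omega), mul_comm, ← le_div_iff₀ (hupos _)] at h₁
      -- This is `y ≤ e ^ (y - 1)` at `y = A * j / 2 ^ R ≥ 4 * j / M`.
      have h₂ : 4 / (M : ℝ) * j ≤ Real.exp (-1 + 2 / R) * Real.exp (A / 2 ^ R * j) := by
        rw [← Real.exp_add]
        have h₃ := Real.add_one_le_exp (-1 + 2 / (R : ℝ) + A / 2 ^ R * j)
        have h₄ : 0 ≤ 2 / (R : ℝ) := by positivity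
        have h₅ := mul_le_mul_of_nonneg_right hA₁ (Nat.cast_nonneg (α := ℝ) j)
        linarith
      calc 4 / (M * M : ℝ) * j = 4 / (M : ℝ) * j / M := by field_simp
        _ ≤ Real.exp (-1 + 2 / R) * Real.exp (A / 2 ^ R * j) / M := by gcongr
        _ = Real.exp (-1 + 2 / R) / M * Real.exp (A / 2 ^ R * j) := by ring
        _ ≤ _ := by gcongr
    refine le_trans ?_ (Finset.sum_le_sum hterm)
    rw [← Finset.mul_sum, ← Nat.cast_sum]
    have hgauss : ((∑ j ∈ Finset.range (M + 1), j : ℕ) : ℝ) * 2 = (M + 1) * M := by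
      exact_mod_cast Finset.sum_range_id_mul_two (M + 1)
    rw [div_mul_eq_mul_div, le_div_iff₀ (by positivity)]
    nlinarith
  have hall : ∀ j ≤ M * A, Constructible k d (profile (β * 2 ^ k) R M u (M * A + M - j)) := by
    intro j
    induction j with
    | zero => exact fun _ => hlast
    | succ j ih =>
      intro hj
      have hT := ih (by omega)
      obtain ⟨n, hn⟩ : ∃ n, M * A + M - j = n + 1 := ⟨M * A + M - j - 1, by omega⟩
      rw [hn] at hT
      rw [show M * A + M - (j + 1) = n by omega]
      have hMn : M ≤ n := by omega
      set a := min (n / M) A with ha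
      have ha₁ : 1 ≤ a := by
        refine le_min ((Nat.one_le_div_iff (by omega)).2 hMn) ?_
        by_contra h0
        have : A = 0 := by omega
        rw [this] at hj
        omega
      refine constructible_of_succ hβ₀ rfl (by omega) (by omega) hkM hupos hanti hMn
        (hg _ (by omega)) (hG _ hMn) (hG _ (by omega)) ((min_le_right _ _).trans_lt hA) rfl hd' ?_ hT
      have h₁ := unfinished_mul_exp_le (M := M) hA (c := ((a : ℝ) - 1) / 2 ^ R) (n - M) M (by
        intro i hi hi'
        have h₂ : n / M ≤ i / M + 1 := by
          rw [← Nat.add_div_right _ (by omega)]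
          exact Nat.div_le_div_right (by omega)
        have h₃ : a ≤ min (i / M) A + 1 := by omega
        have h₄ : (a : ℝ) ≤ (min (i / M) A : ℕ) + 1 := by exact_mod_cast h₃
        gcongr
        linarith)
      rw [Nat.sub_add_cancel hMn, mul_comm, ← le_div_iff₀ (hupos _)] at h₁
      rw [hRβ]
      -- Again `y ≤ e ^ (y - 1)`. The rate `a - 1` appears because the preceding `M` generations may
      -- lag by one step, `a + 1` because of rounding; the gap `2 * M / 2 ^ R ≤ 2 / R` is covered by
      -- the `2 / R` in the exponent.
      have h₂ : ((a : ℝ) + 1) * M / 2 ^ R ≤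
          Real.exp (-1 + 2 / R) * Real.exp (((a : ℝ) - 1) / 2 ^ R * M) := by
        rw [← Real.exp_add]
        refine le_trans ?_ (Real.add_one_le_exp _)
        have h₃ : (M : ℝ) / 2 ^ R ≤ 1 / R := by
          rw [div_le_div_iff₀ hQ₀ hR₀]
          nlinarith
        have h₄ : ((a : ℝ) + 1) * M / 2 ^ R = ((a : ℝ) - 1) / 2 ^ R * M + 2 * (M / 2 ^ R) := by ring
        have h₅ : 2 / (R : ℝ) = 2 * (1 / R) := by ring
        linarith
      calc (a : ℝ) + 1 = ((a : ℝ) + 1) * M / 2 ^ R * (2 ^ R / M) := by field_simp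
        _ ≤ Real.exp (-1 + 2 / R) * Real.exp (((a : ℝ) - 1) / 2 ^ R * M) * (2 ^ R / M) := by gcongr
        _ = Real.exp (-1 + 2 / R) / M * 2 ^ R * Real.exp (((a : ℝ) - 1) / 2 ^ R * M) := by ring
        _ ≤ _ := by gcongr
  have hM' := hall (M * A) le_rfl
  rw [Nat.add_sub_cancel_left] at hM'
  refine exists_sparse_of_constructible (by positivity) ?_ (fun i hi => unfinished_eq_one hi) hM'
  refine le_trans ?_ hd'
  refine le_mul_of_one_le_right (by positivity) ?_
  have : 0 ≤ 2 * (5 / (M : ℝ)) + 2 * Real.exp 10 / 2 ^ R := by positivity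
  linarith

/-! ### The local lemma by counting models -/

/-- The assignments that vanish outside `W`. -/
noncomputable def assignments (W : Finset ℕ) : Finset (ℕ → Bool) := by
  classical exact W.powerset.image fun s v => decide (v ∈ s)

theorem mem_assignments {W : Finset ℕ} {a : ℕ → Bool} :
    a ∈ assignments W ↔ ∀ v, v ∉ W → a v = false := by
  classical
  simp only [assignments, Finset.mem_image, Finset.mem_powerset]
  constructor
  · rintro ⟨s, hs, rfl⟩ v hv
    simpa using fun h => hv (hs h)
  · intro h
    refine ⟨W.filter fun v => a v = true, Finset.filter_subset _ _, ?_⟩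
    funext v
    by_cases hv : v ∈ W
    · simp [hv]
    · simp [hv, h v hv]

open Classical in
/-- The assignments on `W` that satisfy all clauses of `S`. -/
noncomputable def models (W : Finset ℕ) (S : CNF ℕ) : Finset (ℕ → Bool) :=
  (assignments W).filter fun a => Satisfies a S

open Classical in
/-- The assignments on `W` that satisfy all clauses of `S` and violate `C`. -/
noncomputable def countermodels (W : Finset ℕ) (C : Clause ℕ) (S : CNF ℕ) : Finset (ℕ → Bool) :=
  (models W S).filter fun a => ∀ p ∈ C, a p.1 ≠ p.2

theorem mem_models {W : Finset ℕ} {S : CNF ℕ} {a : ℕ → Bool} :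
    a ∈ models W S ↔ a ∈ assignments W ∧ Satisfies a S := by
  simp [models]

theorem mem_countermodels {W : Finset ℕ} {C : Clause ℕ} {S : CNF ℕ} {a : ℕ → Bool} :
    a ∈ countermodels W C S ↔ a ∈ models W S ∧ ∀ p ∈ C, a p.1 ≠ p.2 := by
  simp [countermodels]

theorem card_models_insert (W : Finset ℕ) (C : Clause ℕ) (S : CNF ℕ) :
    (models W (insert C S)).card + (countermodels W C S).card = (models W S).card := by
  classical
  rw [← Finset.card_union_of_disjoint]
  · congr 1
    ext a
    simp only [Finset.mem_union, mem_countermodels, mem_models, Satisfies, Finset.mem_insert,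
      forall_eq_or_imp]
    by_cases h : ∃ p ∈ C, a p.1 = p.2
    · have h' : ¬ ∀ p ∈ C, a p.1 ≠ p.2 := by push Not; exact h
      simp only [h, h', true_and, and_false, or_false]
    · have h' : ∀ p ∈ C, a p.1 ≠ p.2 := by push Not at h; exact h
      simp only [h, false_and, and_false, false_or, and_iff_left_iff_imp]
      exact fun _ => h'
  · rw [Finset.disjoint_left]
    intro a ha ha'
    obtain ⟨p, hp, hap⟩ := (mem_models.1 ha).2 C (Finset.mem_insert_self _ _)
    exact (mem_countermodels.1 ha').2 p hp hap

theorem card_countermodels_anti (W : Finset ℕ) (C : Clause ℕ) {S S' : CNF ℕ} (h : S' ⊆ S) :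
    (countermodels W C S).card ≤ (countermodels W C S').card := by
  apply Finset.card_le_card
  intro a ha
  simp only [mem_countermodels, mem_models] at ha ⊢
  exact ⟨⟨ha.1.1, fun D hD => ha.1.2 D (h hD)⟩, ha.2⟩

/-- Violating a clause of size `k` has conditional probability at most `2⁻ᵏ` given clauses that do
not intersect it. -/
theorem card_countermodels_mul_le {W : Finset ℕ} {C : Clause ℕ} {S : CNF ℕ}
    (hW : Clause.vars C ⊆ W) (hS : ∀ D ∈ S, Clause.vars C ∩ Clause.vars D = ∅) :
    (countermodels W C S).card * 2 ^ C.card ≤ (models W S).card := by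
  classical
  rw [← Finset.card_powerset, ← Finset.card_product]
  have hin : ∀ p ∈ C, p.1 ∈ Clause.vars C := fun p hp => Finset.mem_image_of_mem _ hp
  -- `Φ` flips the variables of the literals in `T`. As `a` violates `C`, the only literal of `v`
  -- possibly in `C` is `(v, !a v)`, so `T` is recovered as the set of literals of `C` made true.
  let Φ : (ℕ → Bool) × Finset (Literal ℕ) → ℕ → Bool :=
    fun x v => if (v, !x.1 v) ∈ x.2 then !x.1 v else x.1 v
  have hfix : ∀ a T, T ⊆ C → ∀ v ∉ Clause.vars C, Φ (a, T) v = a v := by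
    intro a T hT v hv
    simp only [Φ]
    rw [if_neg]
    exact fun h => hv (hin _ (hT h))
  have hrec : ∀ a T, T ⊆ C → (∀ p ∈ C, a p.1 ≠ p.2) →
      T = C.filter fun p => Φ (a, T) p.1 = p.2 := by
    intro a T hT ha
    ext p
    rw [Finset.mem_filter]
    by_cases hp : p ∈ C
    · have hlit : (p.1, !a p.1) = p := by
        have := ha p hp
        ext
        · rfl
        · simp only; cases h₁ : a p.1 <;> cases h₂ : p.2 <;> simp_all
      simp only [hp, true_and, Φ, hlit]
      by_cases hpT : p ∈ T
      · simp only [hpT, if_true, true_iff]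
        exact congrArg Prod.snd hlit
      · simp only [hpT, if_false, false_iff]
        exact ha p hp
    · simp only [hp, false_and, iff_false]
      exact fun h => hp (hT h)
  refine Finset.card_le_card_of_injOn Φ ?_ ?_
  · rintro ⟨a, T⟩ hx
    simp only [Finset.coe_product, Set.mem_prod, Finset.mem_coe, Finset.mem_powerset,
      mem_countermodels, mem_models] at hx ⊢
    obtain ⟨⟨⟨ha, hsat⟩, hviol⟩, hT⟩ := hx
    refine ⟨mem_assignments.2 fun v hv => ?_, fun D hD => ?_⟩
    · rw [hfix a T hT v fun h => hv (hW h)]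
      exact mem_assignments.1 ha v hv
    · obtain ⟨p, hp, hap⟩ := hsat D hD
      refine ⟨p, hp, ?_⟩
      rw [hfix a T hT p.1 fun h => ?_, hap]
      have : p.1 ∈ Clause.vars C ∩ Clause.vars D :=
        Finset.mem_inter.2 ⟨h, Finset.mem_image_of_mem _ hp⟩
      rw [hS D hD] at this
      simp at this
  · rintro ⟨a, T⟩ hx ⟨b, T'⟩ hy hxy
    simp only [Finset.coe_product, Set.mem_prod, Finset.mem_coe, Finset.mem_powerset,
      mem_countermodels] at hx hy
    have hTT : T = T' := by
      rw [hrec a T hx.2 hx.1.2, hrec b T' hy.2 hy.1.2, hxy]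
    subst hTT
    refine Prod.ext ?_ rfl
    funext v
    by_cases h₁ : (v, !a v) ∈ T
    · have := hy.1.2 _ (hx.2 h₁)
      simp only [ne_eq, Bool.eq_not] at this
      simpa using (not_not.1 this).symm
    · by_cases h₂ : (v, !b v) ∈ T
      · have := hx.1.2 _ (hy.2 h₂)
        simp only [ne_eq, Bool.eq_not] at this
        simpa using not_not.1 this
      · have := congrFun hxy v
        simpa only [Φ, h₁, h₂, if_false] using this

/-- Relative to the clauses `S₂` disjoint from `C`, violation has frequency at most `2⁻ᵏ`. Restoring
the at most `d` neighbours in `S₁` one by one keeps, by induction, a fraction at least `1 - x` of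
the models each time. -/
theorem card_countermodels_le {W : Finset ℕ} {F : CNF ℕ} {k d : ℕ} {x : ℝ} (hF : IsKCNF k F)
    (hd : ∀ C ∈ F, (neighbors F C).card ≤ d) (hW : ∀ C ∈ F, Clause.vars C ⊆ W) (hx₀ : 0 ≤ x)
    (hx₁ : x < 1) (hx : (2 ^ k : ℝ)⁻¹ ≤ x * (1 - x) ^ d) {S : CNF ℕ} (hS : S ⊆ F) {C : Clause ℕ}
    (hC : C ∈ F) (hCS : C ∉ S) :
    ((countermodels W C S).card : ℝ) ≤ x * (models W S).card := by
  classical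
  induction S using Finset.strongInduction generalizing C with
  | H S ih =>
  set S₂ := S.filter fun D => Clause.vars C ∩ Clause.vars D = ∅ with hS₂
  set S₁ := S.filter fun D => ¬ Clause.vars C ∩ Clause.vars D = ∅ with hS₁
  have hunion : S₁ ∪ S₂ = S := by rw [Finset.union_comm]; exact Finset.filter_union_filter_not_eq _ _
  have hdisj : Disjoint S₁ S₂ := (Finset.disjoint_filter_filter_not _ _ _).symm
  have hcard : S₁.card ≤ d := by
    refine (Finset.card_le_card ?_).trans (hd C hC)
    intro D hD
    simp only [hS₁, Finset.mem_filter] at hD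
    simp only [neighbors, Finset.mem_filter]
    exact ⟨hS hD.1, fun h => hCS (h ▸ hD.1), Finset.nonempty_iff_ne_empty.2 hD.2⟩
  have hchain : ∀ A ⊆ S₁, (1 - x) ^ A.card * (models W S₂).card ≤ ((models W (A ∪ S₂)).card : ℝ) := by
    intro A
    induction A using Finset.induction_on with
    | empty => simp
    | insert D A hDA ihA =>
      intro hA
      have hD : D ∈ S₁ := hA (Finset.mem_insert_self _ _)
      have hAS : A ⊆ S₁ := (Finset.subset_insert _ _).trans hA
      have hDn : D ∉ A ∪ S₂ := by
        rw [Finset.mem_union, not_or]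
        exact ⟨hDA, Finset.disjoint_left.1 hdisj hD⟩
      have hsub : A ∪ S₂ ⊆ S := by
        rw [← hunion]; exact Finset.union_subset_union_left hAS
      have hDS : D ∈ S := (Finset.mem_filter.1 hD).1
      have h₁ := ih (A ∪ S₂) (Finset.ssubset_iff_subset_ne.2 ⟨hsub, fun h => hDn (h ▸ hDS)⟩)
        (hsub.trans hS) (hS hDS) hDn
      have h₂ := card_models_insert W D (A ∪ S₂)
      rw [Finset.card_insert_of_notMem hDA, Finset.insert_union]
      have h₃ : ((models W (insert D (A ∪ S₂))).card : ℝ) + (countermodels W D (A ∪ S₂)).card =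
        (models W (A ∪ S₂)).card := by exact_mod_cast h₂
      have h₄ := ihA hAS
      have h₅ := mul_le_mul_of_nonneg_left h₄ (sub_nonneg.2 hx₁.le)
      rw [pow_succ]
      nlinarith
  have hmain := hchain S₁ le_rfl
  rw [hunion] at hmain
  have hind : ((countermodels W C S₂).card : ℝ) * 2 ^ k ≤ (models W S₂).card := by
    have := card_countermodels_mul_le (hW C hC) (S := S₂) fun D hD => (Finset.mem_filter.1 hD).2
    rw [hF C hC] at this
    exact_mod_cast this
  calc ((countermodels W C S).card : ℝ) ≤ (countermodels W C S₂).card := by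
        exact_mod_cast card_countermodels_anti W C (Finset.filter_subset _ _)
    _ ≤ (2 ^ k : ℝ)⁻¹ * (models W S₂).card := by
        rw [inv_mul_eq_div, le_div_iff₀ (by positivity)]; exact hind
    _ ≤ x * (1 - x) ^ d * (models W S₂).card := by gcongr
    _ ≤ x * (1 - x) ^ S₁.card * (models W S₂).card := by
        have := pow_le_pow_of_le_one (sub_nonneg.2 hx₁.le) (by linarith : 1 - x ≤ 1) hcard
        gcongr
    _ ≤ x * (models W S).card := by rw [mul_assoc]; gcongr

/-- The symmetric local lemma for `k`-CNF formulas. -/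
theorem admissible_of_inv_two_pow_le {k d : ℕ} {x : ℝ} (hx₀ : 0 ≤ x) (hx₁ : x < 1)
    (hx : (2 ^ k : ℝ)⁻¹ ≤ x * (1 - x) ^ d) : Admissible k d := by
  classical
  intro F hF hd
  set W := F.biUnion Clause.vars with hWdef
  have hW : ∀ C ∈ F, Clause.vars C ⊆ W := fun C hC => Finset.subset_biUnion_of_mem _ hC
  have hpos : ∀ S ⊆ F, 0 < ((models W S).card : ℝ) := by
    intro S
    induction S using Finset.induction_on with
    | empty =>
      intro _
      have : (fun _ => false) ∈ models W ∅ := by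
        simp [mem_models, Satisfies, mem_assignments]
      exact_mod_cast Finset.card_pos.2 ⟨_, this⟩
    | insert C S hCS ih =>
      intro hS
      have h₁ := ih ((Finset.subset_insert _ _).trans hS)
      have h₂ := card_countermodels_le hF hd hW hx₀ hx₁ hx ((Finset.subset_insert _ _).trans hS)
        (hS (Finset.mem_insert_self _ _)) hCS
      have h₃ : ((models W (insert C S)).card : ℝ) + (countermodels W C S).card =
        (models W S).card := by exact_mod_cast card_models_insert W C S
      nlinarith
  obtain ⟨a, ha⟩ := Finset.card_pos.1 (by exact_mod_cast hpos F le_rfl : 0 < (models W F).card)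
  exact ⟨a, (mem_models.1 ha).2⟩

theorem admissible_zero {k : ℕ} (hk : 1 ≤ k) : Admissible k 0 := by
  refine admissible_of_inv_two_pow_le (x := 1 / 2) (by norm_num) (by norm_num) ?_
  have : (2 : ℝ) ^ 1 ≤ 2 ^ k := pow_le_pow_right₀ (by norm_num) hk
  rw [pow_zero, mul_one, one_div]
  exact inv_anti₀ (by norm_num) (by simpa using this)

theorem admissible_of_le_two_pow_div_exp {k d : ℕ} (hk : 1 ≤ k)
    (h : (d + 1 : ℝ) ≤ 2 ^ k / Real.exp 1) : Admissible k d := by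
  -- For `d = 0` the choice `x = 1 / (d + 1)` would be `1`, which is not allowed.
  rcases Nat.eq_zero_or_pos d with rfl | hd
  · exact admissible_zero hk
  have hd' : (0 : ℝ) < d := by exact_mod_cast hd
  refine admissible_of_inv_two_pow_le (x := 1 / (d + 1)) (by positivity)
    (by rw [div_lt_one (by positivity)]; linarith) ?_
  have h₁ : (1 : ℝ) - 1 / ((d : ℝ) + 1) = (1 + 1 / (d : ℝ))⁻¹ := by
    field_simp; ring
  have h₂ : (1 + 1 / (d : ℝ)) ^ d ≤ Real.exp 1 := by
    calc (1 + 1 / (d : ℝ)) ^ d ≤ (Real.exp (1 / d)) ^ d := by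
          gcongr
          linarith [Real.add_one_le_exp (1 / (d : ℝ))]
      _ = Real.exp 1 := by rw [← Real.exp_nat_mul]; congr 1; field_simp
  have h₃ : (d + 1 : ℝ) * (1 + 1 / (d : ℝ)) ^ d ≤ 2 ^ k := by
    rw [le_div_iff₀ (Real.exp_pos 1)] at h
    exact (mul_le_mul_of_nonneg_left h₂ (by positivity)).trans h
  rw [h₁, inv_pow, one_div, ← mul_inv]
  exact inv_anti₀ (by positivity) h₃

/-! ### Bounds for `l` -/

theorem Admissible.mono {k d d' : ℕ} (h : Admissible k d) (hd : d' ≤ d) : Admissible k d' :=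
  fun F hF hn => h F hF fun C hC => (hn C hC).trans hd

theorem Admissible.lt_of_not {k d d' : ℕ} (h : Admissible k d) (h' : ¬ Admissible k d') : d < d' :=
  lt_of_not_ge fun hle => h' (h.mono hle)

/-- A crude bound from the complete tree of height `k`. It makes the supremum in `l` a maximum and
handles small `k`. -/
theorem not_admissible_mul_two_pow (k : ℕ) : ¬ Admissible k (k * 2 ^ k) := by
  have hleaf : ∀ m, ∑ i ∈ Finset.range m, leafCount leaf i ≤ 1 := by
    intro m
    cases m with
    | zero => simp
    | succ m => rw [Finset.sum_range_succ']; simp [leafCount]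
  have hpow : ∀ j ≤ k, 2 ^ j ≤ 2 ^ k := fun j hj => Nat.pow_le_pow_right (by norm_num) hj
  refine not_admissible_of_sparse (T := complete k fun _ => leaf)
    (sparse_complete (fun _ => (hleaf k).trans Nat.one_le_two_pow) fun j hj o => ?_)
    fun i hi => leafCount_complete_of_lt _ hi
  refine (Finset.sum_le_card_nsmul _ _ 1 fun v _ => hleaf _).trans ?_
  simpa using hpow j hj

theorem isGreatest_l {k : ℕ} (hk : 1 ≤ k) : IsGreatest {d : ℕ | Admissible k d} (l k) := by
  have hbdd : BddAbove {d : ℕ | Admissible k d} :=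
    ⟨k * 2 ^ k, fun d hd => (Admissible.lt_of_not hd (not_admissible_mul_two_pow k)).le⟩
  exact ⟨Nat.sSup_mem ⟨0, admissible_zero hk⟩ hbdd, fun d hd => le_csSup hbdd hd⟩

theorem floor_two_pow_div_exp_sub_one_le_l {k : ℕ} (hk : 1 ≤ k) :
    ⌊(2 : ℝ) ^ k / Real.exp 1⌋ - 1 ≤ (l k : ℤ) := by
  rcases le_or_gt (⌊(2 : ℝ) ^ k / Real.exp 1⌋ - 1) 0 with h | h
  · exact h.trans (Int.natCast_nonneg _)
  · obtain ⟨d, hd⟩ := Int.eq_ofNat_of_zero_le h.le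
    rw [hd]
    have hadm : Admissible k d := by
      apply admissible_of_le_two_pow_div_exp hk
      have h₁ := Int.floor_le ((2 : ℝ) ^ k / Real.exp 1)
      have h₂ : ⌊(2 : ℝ) ^ k / Real.exp 1⌋ = (d : ℤ) + 1 := by omega
      rw [h₂] at h₁
      exact_mod_cast h₁
    exact_mod_cast (isGreatest_l hk).2 hadm

/-- With `R = ⌊√k⌋`, each of `e ^ (2 / R)`, `k / (R * m)` and `1 + 11 / m` is `1 + O(1 / m)`;
rounding `X` up costs only `k / 2 ^ k`. -/
theorem l_div_two_pow_le {k : ℕ} (hk : 900 ≤ k) :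
    (l k : ℝ) / 2 ^ k ≤ (Real.exp 1)⁻¹ + 719 / √k := by
  set R := Nat.sqrt k with hR
  have hR30 : 30 ≤ R := Nat.le_sqrt.2 (by omega)
  have hRk : R * R ≤ k := Nat.sqrt_le k
  have hkR : k ≤ R * R + R + R := Nat.sqrt_le_add k
  have hR' : (30 : ℝ) ≤ R := by exact_mod_cast hR30
  set m : ℝ := R - 3 with hm
  have hm27 : 27 ≤ m := by linarith
  have hm₀ : 0 < m := by linarith
  have hR₀ : (0 : ℝ) < R := by linarith
  have hk₀ : (0 : ℝ) < k := by exact_mod_cast (by omega : 0 < k)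
  set X := Real.exp (-1 + 2 / R) / (R * m) * 2 ^ k * (1 + 11 / m) with hX
  have hX₀ : 0 ≤ X := by positivity
  obtain ⟨T, hT, hT'⟩ := exists_sparse_tree (d := ⌈X⌉₊) hR30 hRk (Nat.le_ceil X)
  have hlt : l k < k * ⌈X⌉₊ :=
    Admissible.lt_of_not (isGreatest_l (by omega)).1 (not_admissible_of_sparse hT hT')
  have hl : (l k : ℝ) ≤ k * (X + 1) := by
    calc (l k : ℝ) ≤ k * (⌈X⌉₊ : ℝ) := by exact_mod_cast hlt.le
      _ ≤ k * (X + 1) := by gcongr; exact (Nat.ceil_lt_add_one hX₀).le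
  have hexp : Real.exp (2 / R) ≤ 1 + 4 / m := by
    have h₁ : 1 - 2 / (R : ℝ) ≤ Real.exp (-(2 / R)) := by
      linarith [Real.add_one_le_exp (-(2 / (R : ℝ)))]
    rw [Real.exp_neg] at h₁
    have h₂ : 2 / (R : ℝ) ≤ 2 / m := by gcongr; linarith
    have h₃ : 2 / m ≤ 1 / 2 := by rw [div_le_div_iff₀ hm₀ two_pos]; linarith
    have h₄ : 0 < 2 / m := by positivity
    have h₅ : (1 + 4 / m)⁻¹ ≤ (Real.exp (2 / R))⁻¹ := by
      refine le_trans ?_ h₁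
      rw [inv_le_iff_one_le_mul₀ (by positivity)]
      have : 4 / m = 2 * (2 / m) := by ring
      rw [this]
      nlinarith
    exact (inv_le_inv₀ (by positivity) (Real.exp_pos _)).1 h₅
  have hkm : (k : ℝ) / (R * m) ≤ 1 + 5 / m := by
    have : (k : ℝ) ≤ R * R + R + R := by exact_mod_cast hkR
    rw [div_le_iff₀ (by positivity)]
    have e : (1 + 5 / m) * (R * m) = R * (m + 5) := by field_simp
    rw [e, hm]; nlinarith
  -- Powers of `1 / m ≤ 1` are replaced by `1 / m`, so the constant is `5 * 6 * 12 - 1`.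
  have hprod : (1 + 4 / m) * (1 + 5 / m) * (1 + 11 / m) ≤ 1 + 359 / m := by
    have h₁ : 1 / m ≤ 1 := by rw [div_le_one hm₀]; linarith
    have h₀ : 0 < 1 / m := by positivity
    have e₁ : ∀ c : ℝ, c / m = c * (1 / m) := fun c => by ring
    rw [e₁ 4, e₁ 5, e₁ 11, e₁ 359]
    generalize 1 / m = z at *
    have h₂ : z ^ 2 ≤ z := by nlinarith
    have h₃ : z ^ 3 ≤ z := by nlinarith [mul_nonneg h₀.le h₀.le]
    nlinarith
  have hsqrt : 1 / m ≤ 2 / √k := by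
    have hs : √(k : ℝ) ≤ R + 1 := by
      rw [Real.sqrt_le_left (by linarith)]
      have : (k : ℝ) ≤ R * R + R + R := by exact_mod_cast hkR
      nlinarith
    rw [div_le_div_iff₀ hm₀ (Real.sqrt_pos.2 hk₀)]
    linarith
  have hsmall : (k : ℝ) / 2 ^ k ≤ 1 / √k := by
    have h₁ : (k : ℝ) * k ≤ 2 ^ k := by exact_mod_cast sq_le_two_pow (by omega : 4 ≤ k)
    have h₂ : √(k : ℝ) ≤ k := by
      rw [Real.sqrt_le_left hk₀.le]
      have : (1 : ℝ) ≤ k := by exact_mod_cast (by omega : 1 ≤ k)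
      nlinarith
    rw [div_le_div_iff₀ (by positivity) (Real.sqrt_pos.2 hk₀)]
    nlinarith
  have he : (Real.exp 1)⁻¹ ≤ 1 := inv_le_one_of_one_le₀ (Real.one_le_exp zero_le_one)
  have he₀ : 0 < (Real.exp 1)⁻¹ := by positivity
  calc (l k : ℝ) / 2 ^ k ≤ k * (X + 1) / 2 ^ k := by gcongr
    _ = (Real.exp 1)⁻¹ * (Real.exp (2 / R) * (k / (R * m)) * (1 + 11 / m)) + k / 2 ^ k := by
        rw [hX, Real.exp_add, Real.exp_neg]; field_simp
    _ ≤ (Real.exp 1)⁻¹ * ((1 + 4 / m) * (1 + 5 / m) * (1 + 11 / m)) + 1 / √k := by gcongr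
    _ ≤ (Real.exp 1)⁻¹ * (1 + 359 / m) + 1 / √k := by gcongr
    _ = (Real.exp 1)⁻¹ + (Real.exp 1)⁻¹ * (359 * (1 / m)) + 1 / √k := by ring
    _ ≤ (Real.exp 1)⁻¹ + 1 * (359 * (2 / √k)) + 1 / √k := by gcongr
    _ = _ := by ring

theorem abs_l_div_two_pow_sub_le {k : ℕ} (hk : 1 ≤ k) :
    |(l k : ℝ) / 2 ^ k - (Real.exp 1)⁻¹| ≤ 30000 / √k := by
  have hk' : (1 : ℝ) ≤ k := by exact_mod_cast hk
  have hs : 0 < √(k : ℝ) := Real.sqrt_pos.2 (by linarith)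
  have hpow : (k : ℝ) ≤ 2 ^ k := by exact_mod_cast Nat.lt_two_pow_self.le
  have hsk : √(k : ℝ) ≤ k := by
    rw [Real.sqrt_le_left (by linarith)]
    nlinarith
  have he₀ : 0 < (Real.exp 1)⁻¹ := by positivity
  rw [abs_le]
  constructor
  · have h₁ : ((⌊(2 : ℝ) ^ k / Real.exp 1⌋ - 1 : ℤ) : ℝ) ≤ l k := by
      exact_mod_cast floor_two_pow_div_exp_sub_one_le_l hk
    push_cast at h₁
    have h₂ := Int.lt_floor_add_one ((2 : ℝ) ^ k / Real.exp 1)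
    have h₃ : (2 : ℝ) ^ k / Real.exp 1 - 2 ≤ l k := by linarith
    have h₄ : (Real.exp 1)⁻¹ - 2 / 2 ^ k ≤ (l k : ℝ) / 2 ^ k := by
      rw [le_div_iff₀ (by positivity)]
      calc ((Real.exp 1)⁻¹ - 2 / 2 ^ k) * 2 ^ k = 2 ^ k / Real.exp 1 - 2 := by field_simp
        _ ≤ _ := h₃
    have h₅ : (2 : ℝ) / 2 ^ k ≤ 30000 / √k := by
      gcongr
      · norm_num
      · linarith
    linarith
  -- Below `900` the crude bound `l k / 2 ^ k ≤ k` suffices, as `900 * 30 ≤ 30000`.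
  · rcases lt_or_ge k 900 with h | h
    · have h₁ : (l k : ℝ) ≤ k * 2 ^ k := by
        exact_mod_cast (Admissible.lt_of_not (isGreatest_l hk).1 (not_admissible_mul_two_pow k)).le
      have h₂ : (l k : ℝ) / 2 ^ k ≤ k := by rwa [div_le_iff₀ (by positivity)]
      have h₃ : (k : ℝ) ≤ 900 := by exact_mod_cast h.le
      have h₄ : √(k : ℝ) ≤ 30 := by
        rw [Real.sqrt_le_left (by norm_num)]
        linarith
      have h₅ : (k : ℝ) ≤ 30000 / √k := by
        rw [le_div_iff₀ hs]
        nlinarith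
      linarith
    · have h₁ := l_div_two_pow_le h
      have h₂ : 719 / √(k : ℝ) ≤ 30000 / √k := by gcongr; norm_num
      linarith

end KSat

theorem theorem2 :
    (∀ k : ℕ, 1 ≤ k →
      IsGreatest {d : ℕ | KSat.Admissible k d} (KSat.l k) ∧
      ⌊(2 : ℝ) ^ k / Real.exp 1⌋ - 1 ≤ (KSat.l k : ℤ)) ∧
    ∃ K : ℝ, ∀ k : ℕ, 1 ≤ k →
      ∃ ε : ℝ, |ε| ≤ K * (k : ℝ) ^ (-(1 / 2) : ℝ) ∧
        (KSat.l k : ℝ) = ((Real.exp 1)⁻¹ + ε) * 2 ^ k := by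
  refine ⟨fun k hk => ⟨KSat.isGreatest_l hk, KSat.floor_two_pow_div_exp_sub_one_le_l hk⟩,
    30000, fun k hk => ⟨KSat.l k / 2 ^ k - (Real.exp 1)⁻¹, ?_, ?_⟩⟩
  · rw [Real.rpow_neg (Nat.cast_nonneg k), ← Real.sqrt_eq_rpow, ← div_eq_mul_inv]
    exact KSat.abs_l_div_two_pow_sub_le hk
  · rw [add_sub_cancel, div_mul_cancel₀ _ (by positivity)]
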